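/- **Theorem 5.2.** Consider spin chains on $\mathbb{Z}$ with one-site space $\mathbb{C}^d$, $d\ge 1$. For finite $\Lambda\subset\mathbb{Z}$ put $\mathcal{H}_\Lambda=\bigotimes_{x\in\Lambda}\mathbb{C}^d$ and $\mathfrak{A}_\Lambda=\mathcal{B}(\mathcal{H}_\Lambda)$; for $\Lambda\subseteq I$, identify $\mathfrak{A}_\Lambda$ with a subalgebra of $\mathfrak{A}_I$ through $Q\mapsto Q\otimes\mathbf{1}_{I\setminus\Lambda}$. An interaction is a family $\Phi=(\Phi_X)_X$, indexed by the finite subsets $X$ of $\mathbb{Z}$, with $\Phi_X=\Phi_X^*\in\mathfrak{A}_X$. It has range $r$ and strength $J$ if $\Phi_X=0$ whenever $\operatorname{diam}(X)>r$, and $\|\Phi_X\|\le J$ (operator norm) for all $X$. Let $$H_\Lambda=\sum_{X\subseteq\Lambda}\Phi_X,\qquad \rho^\Lambda=\frac{e^{-H_\Lambda}}{\operatorname{Tr}(e^{-H_\Lambda})}.$$ For every integer $r\ge 1$ and every real $J>0$ there is a positive, (strictly) decreasing function $\varepsilon:\mathbb{N}\to(0,\infty)$, depending only on $r$ and $J$,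 with superexponential decay, that is, $\lim_{\ell\to\infty}\varepsilon(\ell)\,e^{c\ell}=0$ for every $c\in\mathbb{R}$, such that the following holds. Let $d\ge 1$, let $\Phi$ be an interaction of range $r$ and strength $J$, let $I\subset\mathbb{Z}$ be a finite interval split into three consecutive, possibly empty, intervals $I=ABC$ (with $B$ between $A$ and $C$), and let $\ell\in\mathbb{N}$ with $|B|\ge\ell$. Write $\rho=\rho_{ABC}=\rho^I$ for the Gibbs state on $I$, and $\rho_\Lambda=\operatorname{Tr}_{I\setminus\Lambda}(\rho)\in\mathfrak{A}_\Lambda\subseteq\mathfrak{A}_I$ for its marginal on $\Lambda\subseteq I$ (unnormalized partial trace). Then $\rho_B$ is invertible and $$\big\|\rho_{ABC}-\rho_{AB}\,\rho_B^{-1}\,\rho_{BC}\big\|_1\le\varepsilon(\ell),$$ where $\|\cdot\|_1$ is the trace norm (Schatten 1-norm) on $\mathfrak{A}_I$. -/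

import Mathlib

open scoped Matrix

noncomputable section

namespace SpinChain

/-- Classical configurations of the spins on `Λ`. They label the product basis of
`ℋ_Λ = ⨂_{x ∈ Λ} ℂ^d`. -/
abbrev Config (d : ℕ) (Λ : Finset ℤ) : Type := ↥Λ → Fin d

/-- The algebra `𝔄_Λ = ℬ(⨂_{x ∈ Λ} ℂ^d)` of observables on `Λ`, written as matrices in the
orthonormal product basis. -/
abbrev Obs (d : ℕ) (Λ : Finset ℤ) : Type := Matrix (Config d Λ) (Config d Λ) ℂ

section
open scoped Matrix.Norms.L2Operator

/-- The operator norm of an observable (with respect to the Hilbert space norm). -/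
def opNorm {d : ℕ} {Λ : Finset ℤ} (Q : Obs d Λ) : ℝ := ‖Q‖

end

/-- The trace norm (Schatten 1-norm) `Tr √(Qᴴ Q)`: the sum of the singular values of `Q`,
i.e. of the square roots of the eigenvalues of `Qᴴ * Q` counted with multiplicity. -/
def traceNorm {d : ℕ} {Λ : Finset ℤ} (Q : Obs d Λ) : ℝ :=
  ∑ i, Real.sqrt ((Matrix.isHermitian_conjTranspose_mul_self Q).eigenvalues i)

/-- The restriction to `Λ` of a configuration on `I ⊇ Λ`. -/
def restrict {d : ℕ} {Λ I : Finset ℤ} (h : Λ ⊆ I) (σ : Config d I) : Config d Λ :=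
  fun x => σ ⟨x, h x.2⟩

/-- The configuration on `I` that is `σ` on `Λ` and `ω` on `I \ Λ`. -/
def glue {d : ℕ} {Λ I : Finset ℤ} (σ : Config d Λ) (ω : Config d (I \ Λ)) : Config d I :=
  fun x => if hx : (x : ℤ) ∈ Λ then σ ⟨x, hx⟩
    else ω ⟨x, Finset.mem_sdiff.2 ⟨x.2, hx⟩⟩

/-- The canonical embedding `𝔄_Λ → 𝔄_I`, `Q ↦ Q ⊗ 1_{I \ Λ}`, for `Λ ⊆ I`. -/
def embed {d : ℕ} {Λ I : Finset ℤ} (h : Λ ⊆ I) (Q : Obs d Λ) : Obs d I :=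
  Matrix.of fun σ τ =>
    if restrict (Λ := I \ Λ) Finset.sdiff_subset σ = restrict Finset.sdiff_subset τ
    then Q (restrict h σ) (restrict h τ) else 0

/-- The (unnormalized) partial trace over `I \ Λ`, with values in `𝔄_Λ`. -/
def partialTrace {d : ℕ} {I : Finset ℤ} (Λ : Finset ℤ) (Q : Obs d I) : Obs d Λ :=
  Matrix.of fun σ τ => ∑ ω : Config d (I \ Λ), Q (glue σ ω) (glue τ ω)

/-- The reduced operator `ρ_Λ` of `ρ` on `Λ ⊆ I`, viewed in `𝔄_I`:
the partial trace over `I \ Λ`, tensored with the identity of `I \ Λ`. -/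
def reduced {d : ℕ} {Λ I : Finset ℤ} (h : Λ ⊆ I) (ρ : Obs d I) : Obs d I :=
  embed h (partialTrace Λ ρ)

/-- A local interaction on `ℤ`: a self-adjoint observable `Φ_X ∈ 𝔄_X` for every finite `X ⊂ ℤ`. -/
structure Interaction (d : ℕ) where
  toFun : ∀ X : Finset ℤ, Obs d X
  isHermitian : ∀ X, (toFun X).IsHermitian

/-- `Φ` has range `r`: `Φ_X = 0` whenever the diameter of `X` is greater than `r`. -/
def Interaction.HasRange {d : ℕ} (Φ : Interaction d) (r : ℕ) : Prop :=
  ∀ X : Finset ℤ, (∃ x ∈ X, ∃ y ∈ X, (r : ℤ) < |x - y|) → Φ.toFun X = 0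

/-- `Φ` has strength `J`: `‖Φ_X‖ ≤ J` for all `X`. -/
def Interaction.HasStrength {d : ℕ} (Φ : Interaction d) (J : ℝ) : Prop :=
  ∀ X : Finset ℤ, opNorm (Φ.toFun X) ≤ J

/-- The Hamiltonian `H_Λ = ∑_{X ⊆ Λ} Φ_X`. -/
def Interaction.hamiltonian {d : ℕ} (Φ : Interaction d) (Λ : Finset ℤ) : Obs d Λ :=
  ∑ X ∈ Λ.powerset.attach, embed (Finset.mem_powerset.1 X.2) (Φ.toFun X.1)

/-- The Gibbs state `ρ^Λ = e^{-H_Λ} / Tr(e^{-H_Λ})`. -/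
def Interaction.gibbs {d : ℕ} (Φ : Interaction d) (Λ : Finset ℤ) : Obs d Λ :=
  (Matrix.trace (NormedSpace.exp (-Φ.hamiltonian Λ)))⁻¹ • NormedSpace.exp (-Φ.hamiltonian Λ)

/-- The marginal `ρ^I_Λ` on `Λ ⊆ I` of the Gibbs state `ρ^I`, viewed in `𝔄_I`. -/
def Interaction.marginal {d : ℕ} (Φ : Interaction d) {Λ I : Finset ℤ} (h : Λ ⊆ I) : Obs d I :=
  reduced h (Φ.gibbs I)

/-- Superexponential decay: `ε` tends to zero faster than every exponential `e^{-cℓ}`. -/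
def SuperexpDecay (ε : ℕ → ℝ) : Prop :=
  ∀ c : ℝ, Filter.Tendsto (fun ℓ : ℕ => ε ℓ * Real.exp (c * ℓ)) Filter.atTop (nhds 0)

end SpinChain

end

/-! Put h_Λ = H_Λ/2, so that G = e^{-H} factors as e^{-h} e^{-h}. The engine is Araki's expansional
e^{-h_{[a,b)}} e^{h_{[a,m)} + h_{[m,b)}}, which removes the interaction across the cut m. It and its
inverse are bounded by a constant depending only on r and J, and up to a superexponentially small
error it depends only on the sites near m (`IsLocalFamily.norm_expansional_le`,
`IsLocalFamily.norm_expansional_sub_le`). Both facts come from growing a window around the cut in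
steps of r: each new layer of terms commutes with everything inside the last window but one, and
this makes the n-th step at most g^{n+1}/n!.

Tracing out A or C against its own Gibbs weight is a unital completely positive map, and it
expresses the marginals through expansionals. `MarkovData.defect_eq` gives, for the unnormalized
marginals, G - G_AB G_B⁻¹ G_BC = e^{-(h_AB + h_C)} D e^{-(h_A + h_BC)}, with D built from
expansionals at the cuts A|B and B|C and their images under these maps. Split B in the middle. Up to
small errors the expansionals at A|B become one operator X living left of the middle, those at B|C
one operator Y living right of it; X and Y commute, and with them in place the two terms of D cancel
exactly. Hence the operator norm of D is superexponentially small (`norm_markov_defect_le`).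

Finally Hölder's inequality (`traceNorm_mul_mul_le`) bounds the trace norm by the operator norm of D
and two Hilbert-Schmidt norms. The squares of the latter are at most a constant times Tr e^{-H}
(`hsSq_exp_le`), so normalization makes the bound independent of d and of the length of I. -/

noncomputable section

namespace SpinChain

/-! ### Propagators of growing pairs of generators: factorial decay of the increments. -/

section Expansional

variable {𝔸 : Type*} [NormedRing 𝔸] [NormedAlgebra ℝ 𝔸]

theorem exp_add_commute [CompleteSpace 𝔸] {x y : 𝔸} (h : Commute x y) :
    NormedSpace.exp (x + y) = NormedSpace.exp x * NormedSpace.exp y := by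
  let _ := NormedAlgebra.restrictScalars ℚ ℝ 𝔸
  exact NormedSpace.exp_add_of_commute h

theorem exp_neg_mul_exp [CompleteSpace 𝔸] (x : 𝔸) : NormedSpace.exp (-x) * NormedSpace.exp x = 1 := by
  rw [← exp_add_commute (Commute.refl x).neg_left, neg_add_cancel, NormedSpace.exp_zero]

theorem exp_mul_exp_neg [CompleteSpace 𝔸] (x : 𝔸) : NormedSpace.exp x * NormedSpace.exp (-x) = 1 := by
  rw [← exp_add_commute (Commute.refl x).neg_right, add_neg_cancel, NormedSpace.exp_zero]

/-- The relative propagator `e^{-sP} e^{sQ}`. -/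
def propagator (P Q : 𝔸) (s : ℝ) : 𝔸 :=
  NormedSpace.exp (s • (-P)) * NormedSpace.exp (s • Q)


theorem propagator_zero (P Q : 𝔸) : propagator P Q 0 = 1 := by
  simp [propagator]


theorem propagator_one (P Q : 𝔸) :
    propagator P Q 1 = NormedSpace.exp (-P) * NormedSpace.exp Q := by
  simp [propagator]

theorem hasDerivAt_propagator [CompleteSpace 𝔸] (P Q : 𝔸) (s : ℝ) :
    HasDerivAt (propagator P Q) (-P * propagator P Q s + propagator P Q s * Q) s := by
  have := (hasDerivAt_exp_smul_const' (𝕂 := ℝ) (-P) s).mul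
    (hasDerivAt_exp_smul_const (𝕂 := ℝ) Q s)
  refine this.congr_deriv ?_
  simp only [propagator, mul_assoc]


theorem commute_propagator {K P Q : 𝔸} (hP : Commute K P) (hQ : Commute K Q) (s : ℝ) :
    Commute K (propagator P Q s) :=
  ((hP.neg_right.smul_right s).exp_right).mul_right ((hQ.smul_right s).exp_right)

/-- The increments of the relative propagators of a sequence of pairs. -/
def propagatorStep (P Q : ℕ → 𝔸) (s : ℝ) : ℕ → 𝔸
  | 0 => propagator (P 0) (Q 0) s
  | n + 1 => propagator (P (n + 1)) (Q (n + 1)) s - propagator (P n) (Q n) s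


theorem sum_propagatorStep (P Q : ℕ → 𝔸) (s : ℝ) (n : ℕ) :
    ∑ k ∈ Finset.range (n + 1), propagatorStep P Q s k = propagator (P n) (Q n) s := by
  induction n with
  | zero => simp [propagatorStep]
  | succ n ih => rw [Finset.sum_range_succ, ih]; simp [propagatorStep]

/-- The increment solves a linear equation whose source is a commutator with the previous increment
alone. This feedback from step n to step n + 1 produces the factorial. -/
theorem hasDerivAt_propagatorStep_succ [CompleteSpace 𝔸] (P Q K : ℕ → 𝔸)
    (hP : ∀ n, P (n + 1) = P n + K n) (hQ : ∀ n, Q (n + 1) = Q n + K n)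
    (hKP : ∀ n, Commute (K (n + 1)) (P n)) (hKQ : ∀ n, Commute (K (n + 1)) (Q n))
    (n : ℕ) (s : ℝ) :
    HasDerivAt (fun s => propagatorStep P Q s (n + 1))
      (-P (n + 1) * propagatorStep P Q s (n + 1) + propagatorStep P Q s (n + 1) * Q (n + 1)
        - (K n * propagatorStep P Q s n - propagatorStep P Q s n * K n)) s := by
  have h := (hasDerivAt_propagator (P (n + 1)) (Q (n + 1)) s).sub
    (hasDerivAt_propagator (P n) (Q n) s)
  -- The source is the commutator of `K n` with the n-th propagator; since `K n` commutes with the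
  -- propagator before it, only the increment survives.
  have e : K n * propagatorStep P Q s n - propagatorStep P Q s n * K n
      = K n * propagator (P n) (Q n) s - propagator (P n) (Q n) s * K n := by
    cases n with
    | zero => rfl
    | succ n =>
      have := (commute_propagator (hKP n) (hKQ n) s).eq
      simp only [propagatorStep, mul_sub, sub_mul, this]
      abel
  rw [e]
  refine h.congr_deriv ?_
  simp only [propagatorStep, hP, hQ]
  noncomm_ring

/-- Grönwall-type comparison with an explicit barrier. The generators grow linearly in n, which the
exponent absorbs; each integration of the source gains a factor 1/(n + 1). The summand 1 in the rate
gives the strict inequality that the comparison principle needs. -/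
theorem norm_propagatorStep_le [CompleteSpace 𝔸] [NormOneClass 𝔸] (P Q K : ℕ → 𝔸) {c c' : ℝ}
    (hc : 0 ≤ c) (hc' : 0 ≤ c')
    (hP : ∀ n, P (n + 1) = P n + K n) (hQ : ∀ n, Q (n + 1) = Q n + K n)
    (hKP : ∀ n, Commute (K (n + 1)) (P n)) (hKQ : ∀ n, Commute (K (n + 1)) (Q n))
    (hbd : ∀ n : ℕ, ‖P n‖ + ‖Q n‖ ≤ c * (n + 1)) (hK : ∀ n, 2 * ‖K n‖ ≤ c')
    (n : ℕ) : ∀ s ∈ Set.Icc (0 : ℝ) 1,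
      ‖propagatorStep P Q s n‖ ≤ Real.exp ((c + c' + 1) * (n + 1) * s) / n.factorial := by
  have hB : ∀ (n : ℕ) (s : ℝ), HasDerivAt
      (fun s => Real.exp ((c + c' + 1) * (n + 1) * s) / n.factorial)
      ((c + c' + 1) * (n + 1) * (Real.exp ((c + c' + 1) * (n + 1) * s) / n.factorial)) s := by
    intro n s
    have := (((hasDerivAt_id s).const_mul ((c + c' + 1) * ((n : ℝ) + 1))).exp).div_const
      (n.factorial : ℝ)
    refine this.congr_deriv ?_
    simp only [id]
    ring
  have hlin : ∀ (n : ℕ) (D : 𝔸), ‖-P n * D + D * Q n‖ ≤ c * (n + 1) * ‖D‖ := by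
    intro n D
    calc ‖-P n * D + D * Q n‖ ≤ ‖-P n * D‖ + ‖D * Q n‖ := norm_add_le _ _
      _ ≤ ‖P n‖ * ‖D‖ + ‖D‖ * ‖Q n‖ := by
        gcongr
        · exact (norm_mul_le _ _).trans (by rw [norm_neg])
        · exact norm_mul_le _ _
      _ = (‖P n‖ + ‖Q n‖) * ‖D‖ := by ring
      _ ≤ _ := by gcongr; exact hbd n
  induction n with
  | zero =>
    have hd : ∀ s, HasDerivAt (fun s => propagatorStep P Q s 0)
        (-P 0 * propagatorStep P Q s 0 + propagatorStep P Q s 0 * Q 0) s :=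
      fun s => hasDerivAt_propagator (P 0) (Q 0) s
    intro s hs
    refine image_norm_le_of_norm_deriv_right_lt_deriv_boundary
      (f := fun s => propagatorStep P Q s 0)
      (fun x _ => (hd x).continuousAt.continuousWithinAt)
      (fun x _ => (hd x).hasDerivWithinAt) ?_ (hB 0) ?_ hs
    · simp [propagatorStep, propagator_zero]
    · intro x _ hx
      refine (hlin 0 _).trans_lt ?_
      rw [hx]
      gcongr
      linarith
  | succ n ih =>
    have hd := hasDerivAt_propagatorStep_succ P Q K hP hQ hKP hKQ n
    intro s hs
    refine image_norm_le_of_norm_deriv_right_lt_deriv_boundary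
      (f := fun s => propagatorStep P Q s (n + 1))
      (fun x _ => (hd x).continuousAt.continuousWithinAt)
      (fun x _ => (hd x).hasDerivWithinAt) ?_ (hB (n + 1)) ?_ hs
    · simp only [propagatorStep, propagator_zero, sub_self, norm_zero]
      positivity
    · intro x hx hxB
      set a := Real.exp ((c + c' + 1) * (((n + 1 : ℕ) : ℝ) + 1) * x) / (n + 1).factorial with ha
      have ha0 : 0 < a := by positivity
      -- The barrier at level n is at most n + 1 times the barrier at level n + 1, because the
      -- exponent grows with the level.
      have h1 : ‖propagatorStep P Q x n‖ ≤ (n + 1) * a := by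
        refine (ih x ⟨hx.1, hx.2.le⟩).trans ?_
        have : ((n : ℝ) + 1) * a
            = Real.exp ((c + c' + 1) * (((n + 1 : ℕ) : ℝ) + 1) * x) / n.factorial := by
          rw [ha, Nat.factorial_succ]
          push_cast
          field_simp
        rw [this]
        gcongr
        · exact hx.1
        · simp
      calc _ ≤ ‖-P (n + 1) * propagatorStep P Q x (n + 1)
              + propagatorStep P Q x (n + 1) * Q (n + 1)‖
            + ‖K n * propagatorStep P Q x n - propagatorStep P Q x n * K n‖ := norm_sub_le _ _
        _ ≤ c * ((n + 1 : ℕ) + 1) * a + 2 * ‖K n‖ * ‖propagatorStep P Q x n‖ := by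
          gcongr
          · exact (hlin (n + 1) _).trans (by rw [hxB])
          · calc _ ≤ ‖K n * propagatorStep P Q x n‖ + ‖propagatorStep P Q x n * K n‖ :=
                  norm_sub_le _ _
              _ ≤ ‖K n‖ * ‖propagatorStep P Q x n‖ + ‖propagatorStep P Q x n‖ * ‖K n‖ := by
                gcongr <;> exact norm_mul_le _ _
              _ = _ := by ring
        _ ≤ c * ((n + 1 : ℕ) + 1) * a + c' * ((n + 1) * a) := by
          gcongr
          exact hK n
        _ < _ := by
          push_cast
          have : 0 ≤ (n : ℝ) := n.cast_nonneg
          nlinarith [mul_nonneg hc' ha0.le, mul_nonneg this ha0.le]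

end Expansional

/-! ### Tails of the exponential series. -/

/-- The tail `∑_{k ≥ l} g^{k+1} / k!`. -/
def expTail (g : ℝ) (l : ℕ) : ℝ := ∑' k, g ^ (k + l + 1) / (k + l).factorial

theorem summable_pow_succ_div_factorial (g : ℝ) :
    Summable fun k : ℕ => g ^ (k + 1) / k.factorial := by
  refine ((Real.summable_pow_div_factorial g).mul_left g).congr fun k => ?_
  ring

theorem sum_Ico_le_expTail {g : ℝ} (hg : 0 ≤ g) (l N : ℕ) :
    ∑ k ∈ Finset.Ico l N, g ^ (k + 1) / k.factorial ≤ expTail g l := by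
  rw [Finset.sum_Ico_eq_sum_range]
  have hs := (summable_nat_add_iff l).2 (summable_pow_succ_div_factorial g)
  have := hs.sum_le_tsum (Finset.range (N - l)) (fun k _ => by positivity)
  refine le_trans (le_of_eq ?_) this
  exact Finset.sum_congr rfl fun k _ => by rw [add_comm l k]

theorem expTail_nonneg {g : ℝ} (hg : 0 ≤ g) (l : ℕ) : 0 ≤ expTail g l :=
  tsum_nonneg fun k => by positivity

theorem expTail_succ (g : ℝ) (l : ℕ) :
    expTail g l = g ^ (l + 1) / l.factorial + expTail g (l + 1) := by
  have hs := (summable_nat_add_iff l).2 (summable_pow_succ_div_factorial g)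
  unfold expTail
  rw [hs.tsum_eq_zero_add]
  simp only [zero_add]
  congr 1
  exact tsum_congr fun k => by rw [add_right_comm k 1 l, add_assoc k l 1]

theorem expTail_antitone {g : ℝ} (hg : 0 ≤ g) : Antitone (expTail g) :=
  antitone_nat_of_succ_le fun l => by
    rw [expTail_succ g l]
    have : 0 ≤ g ^ (l + 1) / (l.factorial : ℝ) := by positivity
    linarith

theorem tendsto_expTail (g : ℝ) : Filter.Tendsto (expTail g) Filter.atTop (nhds 0) :=
  tendsto_sum_nat_add fun k : ℕ => g ^ (k + 1) / (k.factorial : ℝ)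

/-- An exponential weight is absorbed by enlarging g; since every tail tends to zero, this is
superexponential decay. -/
theorem expTail_mul_pow_le {g t : ℝ} (hg : 0 ≤ g) (ht : 1 ≤ t) (l : ℕ) :
    expTail g l * t ^ (l + 1) ≤ expTail (g * t) l := by
  unfold expTail
  have hs := (summable_nat_add_iff l).2 (summable_pow_succ_div_factorial g)
  have hs' := (summable_nat_add_iff l).2 (summable_pow_succ_div_factorial (g * t))
  rw [← tsum_mul_right]
  refine (hs.mul_right _).tsum_le_tsum (fun k => ?_) hs'
  rw [div_mul_eq_mul_div, mul_pow]
  gcongr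
  omega

/-! ### Windows around a cut, their Hamiltonians and increments. -/

section Window

variable {𝔸 : Type*} [NormedRing 𝔸]

/-- The sum of the terms of an interaction inside `Λ`. -/
def localSum (φ : Finset ℤ → 𝔸) (Λ : Finset ℤ) : 𝔸 := ∑ X ∈ Λ.powerset, φ X

/-- An interaction, with values in a normed ring, of range `r` and strength `J`, whose terms with
disjoint supports commute. -/
structure IsLocalFamily (φ : Finset ℤ → 𝔸) (r : ℕ) (J : ℝ) : Prop where
  range : ∀ X : Finset ℤ, (∃ x ∈ X, ∃ y ∈ X, (r : ℤ) < |x - y|) → φ X = 0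
  strength : ∀ X, ‖φ X‖ ≤ J
  commute : ∀ X Y, Disjoint X Y → Commute (φ X) (φ Y)

/-- The lower end of the window of size `l` around `m`. -/
def winLo (r : ℕ) (a m : ℤ) (l : ℕ) : ℤ := max a (m - r * l)

/-- The upper end of the window of size `l` around `m`. -/
def winHi (r : ℕ) (m b : ℤ) (l : ℕ) : ℤ := min b (m + r * l)

/-- The window of size `l` around `m` in `[a, b)`. -/
def win (r : ℕ) (a m b : ℤ) (l : ℕ) : Finset ℤ := Finset.Ico (winLo r a m l) (winHi r m b l)

theorem mem_win {r : ℕ} {a m b : ℤ} {l : ℕ} {x : ℤ} :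
    x ∈ win r a m b l ↔ (a ≤ x ∧ m - r * l ≤ x) ∧ x < b ∧ x < m + r * l := by
  simp [win, winLo, winHi]

variable {φ : Finset ℤ → 𝔸} {r : ℕ} {J : ℝ}

theorem IsLocalFamily.abs_sub_le (h : IsLocalFamily φ r J) {X : Finset ℤ} (hX : φ X ≠ 0)
    {x y : ℤ} (hx : x ∈ X) (hy : y ∈ X) : |x - y| ≤ r := by
  by_contra hlt
  exact hX (h.range X ⟨x, hx, y, hy, not_le.1 hlt⟩)

theorem IsLocalFamily.strength_nonneg (h : IsLocalFamily φ r J) : 0 ≤ J :=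
  (norm_nonneg _).trans (h.strength ∅)

theorem IsLocalFamily.commute_localSum (h : IsLocalFamily φ r J) {Λ Λ' : Finset ℤ}
    (hd : Disjoint Λ Λ') : Commute (localSum φ Λ) (localSum φ Λ') :=
  Commute.sum_left _ _ _ fun _ hX => Commute.sum_right _ _ _ fun _ hY =>
    h.commute _ _ (hd.mono (Finset.mem_powerset.1 hX) (Finset.mem_powerset.1 hY))

/-- A nonzero term that meets x lies in [x - r, x + r], which has 2^(2r+1) subsets; the summand 1
accounts for the empty set. -/
theorem IsLocalFamily.norm_sum_terms_le (h : IsLocalFamily φ r J) (S : Finset (Finset ℤ))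
    (T : Finset ℤ) (hT : ∀ X ∈ S, X ≠ ∅ → ∃ x ∈ X, x ∈ T) :
    ‖∑ X ∈ S, φ X‖ ≤ J * (1 + T.card * 2 ^ (2 * r + 1)) := by
  classical
  have h1 : ∑ X ∈ S, φ X = ∑ X ∈ S.filter (φ · ≠ 0), φ X := (Finset.sum_filter_ne_zero S).symm
  have h2 : S.filter (φ · ≠ 0) ⊆
      insert ∅ (T.biUnion fun x => (Finset.Icc (x - r) (x + r)).powerset) := by
    intro X hX
    obtain ⟨hXS, hX0⟩ := Finset.mem_filter.1 hX
    rcases eq_or_ne X ∅ with rfl | hne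
    · exact Finset.mem_insert_self _ _
    obtain ⟨x, hx, hxT⟩ := hT X hXS hne
    refine Finset.mem_insert_of_mem (Finset.mem_biUnion.2 ⟨x, hxT, Finset.mem_powerset.2 ?_⟩)
    intro y hy
    have := abs_le.1 (h.abs_sub_le hX0 hx hy)
    exact Finset.mem_Icc.2 ⟨by linarith, by linarith⟩
  have h3 : (S.filter (φ · ≠ 0)).card ≤ 1 + T.card * 2 ^ (2 * r + 1) := by
    refine (Finset.card_le_card h2).trans ((Finset.card_insert_le _ _).trans ?_)
    rw [add_comm]
    gcongr
    refine Finset.card_biUnion_le_card_mul _ _ _ fun x _ => ?_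
    rw [Finset.card_powerset, Int.card_Icc]
    gcongr
    · norm_num
    · omega
  rw [h1]
  calc _ ≤ ∑ X ∈ S.filter (φ · ≠ 0), ‖φ X‖ := norm_sum_le _ _
    _ ≤ (S.filter (φ · ≠ 0)).card • J := Finset.sum_le_card_nsmul _ _ _ fun X _ => h.strength X
    _ ≤ _ := by
      rw [nsmul_eq_mul, mul_comm]
      have := h.strength_nonneg
      gcongr
      exact_mod_cast h3

theorem IsLocalFamily.norm_localSum_le (h : IsLocalFamily φ r J) (Λ : Finset ℤ) :
    ‖localSum φ Λ‖ ≤ J * (1 + Λ.card * 2 ^ (2 * r + 1)) :=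
  h.norm_sum_terms_le _ _ fun X hX hne => by
    obtain ⟨x, hx⟩ := Finset.nonempty_iff_ne_empty.2 hne
    exact ⟨x, hx, Finset.mem_powerset.1 hX hx⟩

/-- The terms that enter the window when its size grows from `l` to `l + 1`. -/
def winIncr (φ : Finset ℤ → 𝔸) (r : ℕ) (a m b : ℤ) (l : ℕ) : 𝔸 :=
  ∑ X ∈ (win r a m b (l + 1)).powerset \ (win r a m b l).powerset, φ X

/-- The Hamiltonian of a window. -/
def winHam (φ : Finset ℤ → 𝔸) (r : ℕ) (a m b : ℤ) (l : ℕ) : 𝔸 := localSum φ (win r a m b l)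

/-- The Hamiltonian of a window, without the terms across the cut at `m`. -/
def winCut (φ : Finset ℤ → 𝔸) (r : ℕ) (a m b : ℤ) (l : ℕ) : 𝔸 :=
  localSum φ (Finset.Ico (winLo r a m l) m) + localSum φ (Finset.Ico m (winHi r m b l))

theorem win_subset_succ (r : ℕ) (a m b : ℤ) (l : ℕ) : win r a m b l ⊆ win r a m b (l + 1) := by
  intro x hx
  rw [mem_win] at hx ⊢
  push_cast
  have : (r : ℤ) * l ≤ r * (l + 1) := by nlinarith
  omega

theorem exists_notMem_win {a m b : ℤ} {l : ℕ} {X : Finset ℤ}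
    (hX : X ∈ (win r a m b (l + 1)).powerset \ (win r a m b l).powerset) :
    ∃ x ∈ X, (a ≤ x ∧ x < b) ∧ (x ∈ Finset.Ico (m - r * (l + 1)) (m - r * l) ∨
      x ∈ Finset.Ico (m + r * l) (m + r * (l + 1) : ℤ)) := by
  rw [Finset.mem_sdiff, Finset.mem_powerset, Finset.mem_powerset, Finset.not_subset] at hX
  obtain ⟨h1, x, hx, hn⟩ := hX
  have h2 := h1 hx
  rw [mem_win] at hn h2
  push_cast at h2
  refine ⟨x, hx, by omega, ?_⟩
  rw [Finset.mem_Ico, Finset.mem_Ico]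
  omega

theorem winHam_succ (φ : Finset ℤ → 𝔸) (r : ℕ) (a m b : ℤ) (l : ℕ) :
    winHam φ r a m b (l + 1) = winHam φ r a m b l + winIncr φ r a m b l := by
  rw [winHam, winHam, winIncr, localSum, localSum,
    ← Finset.sum_sdiff (Finset.powerset_mono.2 (win_subset_succ r a m b l)), add_comm]

/-- Once the window reaches r on both sides, the entering terms cannot cross the cut, so the cut and
uncut Hamiltonians grow by the same increment. This fails from size 0 to size 1, hence the shift of
the window size by one here and in all later uses. -/
theorem IsLocalFamily.winCut_succ (h : IsLocalFamily φ r J) {a m b : ℤ} (ham : a ≤ m)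
    (hmb : m ≤ b) (l : ℕ) :
    winCut φ r a m b (l + 1 + 1) = winCut φ r a m b (l + 1) + winIncr φ r a m b (l + 1) := by
  classical
  set L := Finset.Ico (winLo r a m (l + 1)) m with hL
  set L' := Finset.Ico (winLo r a m (l + 1 + 1)) m with hL'
  set R := Finset.Ico m (winHi r m b (l + 1)) with hR
  set R' := Finset.Ico m (winHi r m b (l + 1 + 1)) with hR'
  have hrl : (r : ℤ) ≤ r * (l + 1) := by nlinarith
  have hrl' : (r : ℤ) * (l + 1) ≤ r * (l + 1 + 1) := by nlinarith
  have memL : ∀ x, x ∈ L ↔ (a ≤ x ∧ m - r * (l + 1) ≤ x) ∧ x < m := by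
    intro x; simp [hL, winLo]
  have memL' : ∀ x, x ∈ L' ↔ (a ≤ x ∧ m - r * (l + 1 + 1) ≤ x) ∧ x < m := by
    intro x; simp [hL', winLo]
  have memR : ∀ x, x ∈ R ↔ m ≤ x ∧ x < b ∧ x < m + r * (l + 1) := by
    intro x; simp [hR, winHi]
  have memR' : ∀ x, x ∈ R' ↔ m ≤ x ∧ x < b ∧ x < m + r * (l + 1 + 1) := by
    intro x; simp [hR', winHi]
  have hLL : L ⊆ L' := fun x hx => by rw [memL] at hx; rw [memL']; omega
  have hRR : R ⊆ R' := fun x hx => by rw [memR] at hx; rw [memR']; omega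
  have hdisj : Disjoint (L'.powerset \ L.powerset) (R'.powerset \ R.powerset) := by
    rw [Finset.disjoint_left]
    intro X hX hX'
    simp only [Finset.mem_sdiff, Finset.mem_powerset] at hX hX'
    obtain ⟨x, hx, -⟩ := Finset.not_subset.1 hX.2
    have h1 := hX.1 hx
    have h2 := hX'.1 hx
    rw [memL'] at h1
    rw [memR'] at h2
    omega
  have hsub : (L'.powerset \ L.powerset) ∪ (R'.powerset \ R.powerset) ⊆
      (win r a m b (l + 1 + 1)).powerset \ (win r a m b (l + 1)).powerset := by
    intro X hX
    simp only [Finset.mem_union, Finset.mem_sdiff, Finset.mem_powerset] at hX ⊢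
    have hLW : ∀ x, x ∈ L' → x ∈ win r a m b (l + 1 + 1) := fun x hx => by
      rw [memL'] at hx; rw [mem_win]; push_cast; omega
    have hRW : ∀ x, x ∈ R' → x ∈ win r a m b (l + 1 + 1) := fun x hx => by
      rw [memR'] at hx; rw [mem_win]; push_cast; omega
    rcases hX with ⟨h1, h2⟩ | ⟨h1, h2⟩ <;> obtain ⟨x, hx, hn⟩ := Finset.not_subset.1 h2 <;>
      have hx' := h1 hx
    · refine ⟨fun y hy => hLW y (h1 hy), fun hW => hn ?_⟩
      have := hW hx
      rw [mem_win] at this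
      rw [memL'] at hx'
      rw [memL]
      push_cast at this
      omega
    · refine ⟨fun y hy => hRW y (h1 hy), fun hW => hn ?_⟩
      have := hW hx
      rw [mem_win] at this
      rw [memR'] at hx'
      rw [memR]
      push_cast at this
      omega
  -- A new term has a point at distance at least r from the cut; if it is on neither side alone it
  -- has diameter greater than r and vanishes.
  have hzero : ∀ X ∈ (win r a m b (l + 1 + 1)).powerset \ (win r a m b (l + 1)).powerset,
      X ∉ (L'.powerset \ L.powerset) ∪ (R'.powerset \ R.powerset) → φ X = 0 := by
    intro X hX hX'
    by_contra h0
    obtain ⟨x, hx, hxab, hxI⟩ := exists_notMem_win hX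
    push_cast at hxI
    have hXW := Finset.mem_powerset.1 (Finset.mem_sdiff.1 hX).1
    simp only [Finset.mem_union, Finset.mem_sdiff, Finset.mem_powerset, not_or, not_and,
      not_not] at hX'
    simp only [Finset.mem_Ico] at hxI
    rcases hxI with hxI | hxI
    · have : ¬ X ⊆ L' := fun hs => by
        have := hX'.1 hs hx
        rw [memL] at this
        omega
      obtain ⟨y, hy, hyn⟩ := Finset.not_subset.1 this
      have hyW := hXW hy
      have := abs_le.1 (h.abs_sub_le h0 hx hy)
      rw [mem_win] at hyW
      rw [memL'] at hyn
      push_cast at hyW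
      omega
    · have : ¬ X ⊆ R' := fun hs => by
        have := hX'.2 hs hx
        rw [memR] at this
        omega
      obtain ⟨y, hy, hyn⟩ := Finset.not_subset.1 this
      have hyW := hXW hy
      have := abs_le.1 (h.abs_sub_le h0 hx hy)
      rw [mem_win] at hyW
      rw [memR'] at hyn
      push_cast at hyW
      omega
  rw [winCut, winCut, winIncr, ← Finset.sum_subset hsub hzero, Finset.sum_union hdisj]
  change localSum φ L' + localSum φ R' = localSum φ L + localSum φ R + _
  rw [localSum, localSum, ← Finset.sum_sdiff (Finset.powerset_mono.2 hLL),
    ← Finset.sum_sdiff (Finset.powerset_mono.2 hRR), localSum, localSum]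
  abel

/-- The entering terms contain a point outside the window of size l + 1, so by their diameter they
cannot come back r sites into the window of size l. -/
theorem IsLocalFamily.commute_winIncr (h : IsLocalFamily φ r J) {a m b : ℤ} (l : ℕ)
    {Λ : Finset ℤ} (hΛ : Λ ⊆ win r a m b l) :
    Commute (winIncr φ r a m b (l + 1)) (localSum φ Λ) := by
  refine Commute.sum_left _ _ _ fun X hX => Commute.sum_right _ _ _ fun Y hY => ?_
  by_cases h0 : φ X = 0
  · rw [h0]; exact Commute.zero_left _
  refine h.commute _ _ (Finset.disjoint_left.2 fun y hyX hyY => ?_)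
  obtain ⟨x, hx, -, hxI⟩ := exists_notMem_win hX
  have hy := hΛ (Finset.mem_powerset.1 hY hyY)
  have := abs_le.1 (h.abs_sub_le h0 hx hyX)
  simp only [Finset.mem_Ico] at hxI
  rw [mem_win] at hy
  push_cast at hxI
  have : (r : ℤ) * (l + 1) = r * l + r := by ring
  omega

theorem IsLocalFamily.norm_winIncr_le (h : IsLocalFamily φ r J) (a m b : ℤ) (l : ℕ) :
    ‖winIncr φ r a m b l‖ ≤ J * (1 + 2 * r * 2 ^ (2 * r + 1)) := by
  refine (h.norm_sum_terms_le _ (Finset.Ico (m - r * (l + 1)) (m - r * l : ℤ) ∪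
    Finset.Ico (m + r * l) (m + r * (l + 1) : ℤ)) fun X hX _ => ?_).trans ?_
  · obtain ⟨x, hx, -, hxI⟩ := exists_notMem_win hX
    exact ⟨x, hx, Finset.mem_union.2 hxI⟩
  · have hc : (Finset.Ico (m - r * (l + 1)) (m - r * l : ℤ) ∪
        Finset.Ico (m + r * l) (m + r * (l + 1) : ℤ)).card ≤ 2 * r := by
      refine (Finset.card_union_le _ _).trans ?_
      rw [Int.card_Ico, Int.card_Ico]
      have : (r : ℤ) * (l + 1) = r * l + r := by ring
      omega
    have := h.strength_nonneg
    gcongr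
    exact_mod_cast hc

theorem IsLocalFamily.norm_winHam_add_norm_winCut_le (h : IsLocalFamily φ r J) {a m b : ℤ}
    (ham : a ≤ m) (hmb : m ≤ b) (l : ℕ) :
    ‖winHam φ r a m b (l + 1)‖ + ‖winCut φ r a m b (l + 1)‖
      ≤ J * (3 + 6 * r * 2 ^ (2 * r + 1)) * (l + 1) := by
  have hJ := h.strength_nonneg
  -- Used three times: for the whole window and for its two halves. This is the origin of the
  -- constants 3 and 6.
  have key : ∀ Λ ⊆ win r a m b (l + 1),
      ‖localSum φ Λ‖ ≤ J * (1 + 2 * r * (l + 1) * 2 ^ (2 * r + 1)) := by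
    intro Λ hΛ
    refine (h.norm_localSum_le Λ).trans ?_
    have hc : Λ.card ≤ 2 * r * (l + 1) := by
      refine (Finset.card_le_card hΛ).trans ?_
      rw [win, Int.card_Ico, winHi, winLo]
      push_cast
      have : ((2 * r * (l + 1) : ℕ) : ℤ) = 2 * (r * (l + 1)) := by push_cast; ring
      omega
    gcongr
    exact_mod_cast hc
  have h0 : (0 : ℤ) ≤ r * ((l + 1 : ℕ) : ℤ) := by positivity
  have k1 := key _ (Finset.Subset.refl _)
  have k2 := key (Finset.Ico (winLo r a m (l + 1)) m) fun x hx => by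
    rw [Finset.mem_Ico, winLo] at hx; rw [mem_win]; omega
  have k3 := key (Finset.Ico m (winHi r m b (l + 1))) fun x hx => by
    rw [Finset.mem_Ico, winHi] at hx; rw [mem_win]; omega
  have k4 : ‖winCut φ r a m b (l + 1)‖ ≤ _ := norm_add_le _ _
  have : (0 : ℝ) ≤ J * l := by positivity
  rw [winHam]
  nlinarith

theorem IsLocalFamily.commute_winIncr_winCut (h : IsLocalFamily φ r J) {a m b : ℤ} (ham : a ≤ m)
    (hmb : m ≤ b) (l : ℕ) : Commute (winIncr φ r a m b (l + 1)) (winCut φ r a m b l) := by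
  have h0 : (0 : ℤ) ≤ r * (l : ℤ) := by positivity
  refine (h.commute_winIncr l fun x hx => ?_).add_right (h.commute_winIncr l fun x hx => ?_)
  · rw [Finset.mem_Ico, winLo] at hx; rw [mem_win]; omega
  · rw [Finset.mem_Ico, winHi] at hx; rw [mem_win]; omega

end Window

/-! ### Boundedness and locality of Araki's expansionals. -/

section Locality

variable {𝔸 : Type*} [NormedRing 𝔸] [NormedAlgebra ℝ 𝔸]

/-- Araki's expansional `e^{-H_{[a,b)}} e^{H_{[a,m)} + H_{[m,b)}}`. -/
def expansional (φ : Finset ℤ → 𝔸) (a m b : ℤ) : 𝔸 :=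
  NormedSpace.exp (-localSum φ (Finset.Ico a b)) *
    NormedSpace.exp (localSum φ (Finset.Ico a m) + localSum φ (Finset.Ico m b))

/-- The inverse of Araki's expansional. -/
def expansionalInv (φ : Finset ℤ → 𝔸) (a m b : ℤ) : 𝔸 :=
  NormedSpace.exp (-(localSum φ (Finset.Ico a m) + localSum φ (Finset.Ico m b))) *
    NormedSpace.exp (localSum φ (Finset.Ico a b))

theorem expansionalInv_mul [CompleteSpace 𝔸] (φ : Finset ℤ → 𝔸) (a m b : ℤ) :
    expansionalInv φ a m b * expansional φ a m b = 1 := by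
  rw [expansional, expansionalInv, mul_assoc,
    ← mul_assoc (NormedSpace.exp (localSum φ _)) (NormedSpace.exp _),
    exp_mul_exp_neg, one_mul, exp_neg_mul_exp]

/-- The growth rate in the locality estimate for expansionals. -/
def arakiRate (r : ℕ) (J : ℝ) : ℝ :=
  Real.exp (J * (3 + 6 * r * 2 ^ (2 * r + 1)) + 2 * (J * (1 + 2 * r * 2 ^ (2 * r + 1))) + 1)

theorem arakiRate_pos (r : ℕ) (J : ℝ) : 0 < arakiRate r J := Real.exp_pos _

variable {φ : Finset ℤ → 𝔸} {r : ℕ} {J : ℝ}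

theorem winLo_eq {r : ℕ} (hr : 0 < r) {a m : ℤ} {l : ℕ} (hl : (m - a).toNat ≤ l) :
    winLo r a m l = a := by
  have : (m - a) ≤ r * l := by
    have h1 : m - a ≤ l := by omega
    have h2 : (l : ℤ) ≤ r * l := by exact_mod_cast Nat.le_mul_of_pos_left l hr
    omega
  rw [winLo]
  omega

theorem winHi_eq {r : ℕ} (hr : 0 < r) {m b : ℤ} {l : ℕ} (hl : (b - m).toNat ≤ l) :
    winHi r m b l = b := by
  have : (b - m) ≤ r * l := by
    have h1 : b - m ≤ l := by omega
    have h2 : (l : ℤ) ≤ r * l := by exact_mod_cast Nat.le_mul_of_pos_left l hr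
    omega
  rw [winHi]
  omega

theorem sum_steps_eq (hr : 0 < r) {a m b : ℤ} {N : ℕ}
    (hN : (m - a).toNat + (b - m).toNat ≤ N) :
    (∑ k ∈ Finset.range (N + 1), propagatorStep (fun k => winHam φ r a m b (k + 1))
      (fun k => winCut φ r a m b (k + 1)) 1 k = expansional φ a m b) ∧
    ∑ k ∈ Finset.range (N + 1), propagatorStep (fun k => winCut φ r a m b (k + 1))
      (fun k => winHam φ r a m b (k + 1)) 1 k = expansionalInv φ a m b := by
  have h1 : winLo r a m (N + 1) = a := winLo_eq hr (by omega)
  have h2 : winHi r m b (N + 1) = b := winHi_eq hr (by omega)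
  constructor
  · rw [sum_propagatorStep, propagator_one, winHam, winCut, win, h1, h2, expansional]
  · rw [sum_propagatorStep, propagator_one, winHam, winCut, win, h1, h2, expansionalInv]

variable [CompleteSpace 𝔸] [NormOneClass 𝔸]

theorem IsLocalFamily.norm_step_le (h : IsLocalFamily φ r J) {a m b : ℤ} (ham : a ≤ m)
    (hmb : m ≤ b) (n : ℕ) :
    ‖propagatorStep (fun k => winHam φ r a m b (k + 1)) (fun k => winCut φ r a m b (k + 1)) 1 n‖
      ≤ arakiRate r J ^ (n + 1) / n.factorial ∧
    ‖propagatorStep (fun k => winCut φ r a m b (k + 1)) (fun k => winHam φ r a m b (k + 1)) 1 n‖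
      ≤ arakiRate r J ^ (n + 1) / n.factorial := by
  have hJ := h.strength_nonneg
  have e : ∀ n : ℕ, arakiRate r J ^ (n + 1) = Real.exp ((J * (3 + 6 * r * 2 ^ (2 * r + 1)) +
      2 * (J * (1 + 2 * r * 2 ^ (2 * r + 1))) + 1) * (n + 1) * 1) := by
    intro n
    rw [arakiRate, ← Real.exp_nat_mul]
    push_cast
    ring_nf
  have hP := fun n : ℕ => winHam_succ φ r a m b (n + 1)
  have hQ := fun n : ℕ => h.winCut_succ ham hmb n
  have hKP : ∀ n : ℕ, Commute (winIncr φ r a m b (n + 1 + 1)) (winHam φ r a m b (n + 1)) :=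
    fun n => h.commute_winIncr (n + 1) (Finset.Subset.refl _)
  have hKQ := fun n : ℕ => h.commute_winIncr_winCut ham hmb (n + 1)
  have hK : ∀ n : ℕ, 2 * ‖winIncr φ r a m b (n + 1)‖ ≤ 2 * (J * (1 + 2 * r * 2 ^ (2 * r + 1))) :=
    fun n => mul_le_mul_of_nonneg_left (h.norm_winIncr_le a m b (n + 1)) zero_le_two
  have hbd := fun n : ℕ => h.norm_winHam_add_norm_winCut_le ham hmb n
  rw [e]
  constructor
  · exact norm_propagatorStep_le _ _ (fun k => winIncr φ r a m b (k + 1)) (by positivity)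
      (by positivity) hP hQ hKP hKQ hbd hK n 1 (by simp)
  · exact norm_propagatorStep_le _ _ (fun k => winIncr φ r a m b (k + 1)) (by positivity)
      (by positivity) hQ hP hKQ hKP (fun n => by rw [add_comm]; exact hbd n) hK n 1 (by simp)

/-- Expansionals and their inverses are bounded uniformly in the size of the intervals. -/
theorem IsLocalFamily.norm_expansional_le (h : IsLocalFamily φ r J) (hr : 0 < r) {a m b : ℤ}
    (ham : a ≤ m) (hmb : m ≤ b) :
    ‖expansional φ a m b‖ ≤ expTail (arakiRate r J) 0 ∧
      ‖expansionalInv φ a m b‖ ≤ expTail (arakiRate r J) 0 := by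
  obtain ⟨e1, e2⟩ := sum_steps_eq (φ := φ) hr (le_refl ((m - a).toNat + (b - m).toNat))
  rw [← e1, ← e2]
  have := sum_Ico_le_expTail (arakiRate_pos r J).le 0 ((m - a).toNat + (b - m).toNat + 1)
  rw [← Finset.range_eq_Ico] at this
  exact ⟨(norm_sum_le _ _).trans ((Finset.sum_le_sum fun n _ =>
      (h.norm_step_le ham hmb n).1).trans this),
    (norm_sum_le _ _).trans ((Finset.sum_le_sum fun n _ =>
      (h.norm_step_le ham hmb n).2).trans this)⟩

/-- Expansionals are superexponentially close to their restrictions to a window at the cut. -/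
theorem IsLocalFamily.norm_expansional_sub_le (h : IsLocalFamily φ r J) (hr : 0 < r)
    {a m b a' b' : ℤ} (ham : a ≤ m) (hmb : m ≤ b) (ham' : a' ≤ m) (hmb' : m ≤ b') (l : ℕ)
    (hlo : winLo r a m l = winLo r a' m l) (hhi : winHi r m b l = winHi r m b' l) :
    ‖expansional φ a m b - expansional φ a' m b'‖ ≤ 2 * expTail (arakiRate r J) l := by
  cases l with
  | zero =>
    refine (norm_sub_le _ _).trans ?_
    have h1 := (h.norm_expansional_le hr ham hmb).1
    have h2 := (h.norm_expansional_le hr ham' hmb').1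
    linarith
  | succ l =>
    -- A common number of steps that exhausts both intervals. The first l + 1 increments sum to the
    -- propagator of the window of size l + 1, which is the same for both, so only two tails remain.
    set N := l + (m - a).toNat + (b - m).toNat + (m - a').toNat + (b' - m).toNat with hN
    rw [← (sum_steps_eq (φ := φ) hr (show (m - a).toNat + (b - m).toNat ≤ N by omega)).1,
      ← (sum_steps_eq (φ := φ) hr (show (m - a').toNat + (b' - m).toNat ≤ N by omega)).1,
      ← Finset.sum_range_add_sum_Ico _ (show l + 1 ≤ N + 1 by omega),
      ← Finset.sum_range_add_sum_Ico _ (show l + 1 ≤ N + 1 by omega),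
      sum_propagatorStep, sum_propagatorStep]
    have e1 : winHam φ r a m b (l + 1) = winHam φ r a' m b' (l + 1) := by
      rw [winHam, winHam, win, win, hlo, hhi]
    have e2 : winCut φ r a m b (l + 1) = winCut φ r a' m b' (l + 1) := by
      rw [winCut, winCut, hlo, hhi]
    rw [e1, e2, add_sub_add_left_eq_sub, two_mul]
    have := sum_Ico_le_expTail (arakiRate_pos r J).le (l + 1) (N + 1)
    refine (norm_sub_le _ _).trans (add_le_add ?_ ?_)
    · exact (norm_sum_le _ _).trans ((Finset.sum_le_sum fun n _ =>
        (h.norm_step_le ham hmb n).1).trans this)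
    · exact (norm_sum_le _ _).trans ((Finset.sum_le_sum fun n _ =>
        (h.norm_step_le ham' hmb' n).1).trans this)

end Locality

/-! ### Completely positive maps in Kraus form and order bounds in C*-algebras. -/

section Kraus

variable {𝔸 : Type*} [CStarAlgebra 𝔸] {ι κ : Type*} [Fintype ι] [Fintype κ]

/-- The completely positive map with Kraus operators `V`. -/
def kraus (V : ι → 𝔸) (Q : 𝔸) : 𝔸 := ∑ i, V i * Q * star (V i)

theorem kraus_sub (V : ι → 𝔸) (Q R : 𝔸) : kraus V (Q - R) = kraus V Q - kraus V R := by
  simp [kraus, mul_sub, sub_mul]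

theorem kraus_add (V : ι → 𝔸) (Q R : 𝔸) : kraus V (Q + R) = kraus V Q + kraus V R := by
  simp [kraus, mul_add, add_mul, Finset.sum_add_distrib]

theorem star_kraus (V : ι → 𝔸) (Q : 𝔸) : star (kraus V Q) = kraus V (star Q) := by
  simp [kraus, mul_assoc]

theorem kraus_algebraMap {V : ι → 𝔸} (hV : kraus V 1 = 1) (k : ℝ) :
    kraus V (algebraMap ℝ 𝔸 k) = algebraMap ℝ 𝔸 k := by
  simp only [kraus, mul_one] at hV
  simp only [kraus, Algebra.algebraMap_eq_smul_one, mul_smul_comm, smul_mul_assoc, mul_one,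
    ← Finset.smul_sum, hV]

theorem kraus_mul_left {V : ι → 𝔸} {x : 𝔸} (hx : ∀ i, Commute x (V i)) (Q : 𝔸) :
    kraus V (x * Q) = x * kraus V Q := by
  simp only [kraus, Finset.mul_sum]
  refine Finset.sum_congr rfl fun i _ => ?_
  rw [← mul_assoc, ← (hx i).eq, mul_assoc, mul_assoc, mul_assoc]

theorem kraus_mul_right {V : ι → 𝔸} {x : 𝔸} (hx : ∀ i, Commute x (star (V i))) (Q : 𝔸) :
    kraus V (Q * x) = kraus V Q * x := by
  simp only [kraus, Finset.sum_mul]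
  refine Finset.sum_congr rfl fun i _ => ?_
  rw [mul_assoc, mul_assoc, (hx i).eq, ← mul_assoc, ← mul_assoc]

theorem commute_kraus {V : ι → 𝔸} {x Q : 𝔸} (hx : ∀ i, Commute x (V i))
    (hx' : ∀ i, Commute x (star (V i))) (hQ : Commute x Q) : Commute x (kraus V Q) :=
  Commute.sum_right _ _ _ fun i _ => ((hx i).mul_right hQ).mul_right (hx' i)

variable [PartialOrder 𝔸] [StarOrderedRing 𝔸]

theorem kraus_nonneg (V : ι → 𝔸) {Q : 𝔸} (hQ : 0 ≤ Q) : 0 ≤ kraus V Q :=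
  Finset.sum_nonneg fun i _ => star_right_conjugate_nonneg hQ (V i)

theorem kraus_mono (V : ι → 𝔸) {Q R : 𝔸} (h : Q ≤ R) : kraus V Q ≤ kraus V R := by
  rw [← sub_nonneg, ← kraus_sub]
  exact kraus_nonneg V (sub_nonneg.2 h)

theorem norm_kraus_le_of_nonneg {V : ι → 𝔸} (hV : kraus V 1 = 1) {Q : 𝔸} (hQ : 0 ≤ Q) :
    ‖kraus V Q‖ ≤ ‖Q‖ := by
  rw [CStarAlgebra.norm_le_iff_le_algebraMap _ (norm_nonneg _) (kraus_nonneg V hQ),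
    ← kraus_algebraMap hV]
  exact kraus_mono V (IsSelfAdjoint.of_nonneg hQ).le_algebraMap_norm_self

/-- Shifting Q by its norm makes it positive, where contractivity is available. The shift costs the
factor 3, which is harmless here. -/
theorem norm_kraus_le [NormOneClass 𝔸] {V : ι → 𝔸} (hV : kraus V 1 = 1) {Q : 𝔸}
    (hQ : IsSelfAdjoint Q) : ‖kraus V Q‖ ≤ 3 * ‖Q‖ := by
  have h0 : 0 ≤ Q + algebraMap ℝ 𝔸 ‖Q‖ := by
    have := hQ.neg_algebraMap_norm_le_self
    exact neg_le_iff_add_nonneg.1 this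
  have h1 := norm_kraus_le_of_nonneg hV h0
  have hn : ‖algebraMap ℝ 𝔸 ‖Q‖‖ = ‖Q‖ := by rw [norm_algebraMap', norm_norm]
  have h2 : kraus V Q = kraus V (Q + algebraMap ℝ 𝔸 ‖Q‖) - algebraMap ℝ 𝔸 ‖Q‖ := by
    rw [kraus_add, kraus_algebraMap hV, add_sub_cancel_right]
  rw [h2]
  refine (norm_sub_le _ _).trans ?_
  have h3 : ‖Q + algebraMap ℝ 𝔸 ‖Q‖‖ ≤ ‖Q‖ + ‖Q‖ := (norm_add_le _ _).trans (by rw [hn])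
  rw [hn]
  linarith

/-- Conjugate F'* F' ≤ k² by F. A lower bound of this kind survives unital positive maps, so the
images of F* F stay invertible. -/
theorem algebraMap_le_star_mul_self {F F' : 𝔸} {k : ℝ} (hk : 0 < k) (hF : F' * F = 1)
    (hn : ‖F'‖ ≤ k) : algebraMap ℝ 𝔸 (k ^ 2)⁻¹ ≤ star F * F := by
  have h1 : star F' * F' ≤ algebraMap ℝ 𝔸 (k ^ 2) :=
    CStarAlgebra.star_mul_le_algebraMap_norm_sq.trans (by gcongr)
  have h2 := star_left_conjugate_le_conjugate h1 F
  have h3 : star F * (star F' * F') * F = 1 := by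
    calc star F * (star F' * F') * F = star (F' * F) * (F' * F) := by
          rw [star_mul]; simp only [mul_assoc]
      _ = 1 := by simp [hF]
  rw [h3, Algebra.algebraMap_eq_smul_one, mul_smul_comm, smul_mul_assoc, mul_one] at h2
  rw [Algebra.algebraMap_eq_smul_one]
  calc (k ^ 2)⁻¹ • (1 : 𝔸) ≤ (k ^ 2)⁻¹ • (k ^ 2 • (star F * F)) :=
        smul_le_smul_of_nonneg_left h2 (by positivity)
    _ = star F * F := inv_smul_smul₀ (by positivity) _

/-- Inversion is operator antitone on positive invertible elements. -/
theorem exists_inverse_of_algebraMap_le {S : 𝔸} {k : ℝ} (hk : 0 < k)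
    (h : algebraMap ℝ 𝔸 k⁻¹ ≤ S) :
    ∃ R, R * S = 1 ∧ S * R = 1 ∧ ‖R‖ ≤ k := by
  let u : 𝔸ˣ := Units.map (algebraMap ℝ 𝔸).toMonoidHom (Units.mk0 k⁻¹ (by positivity))
  have hu : (u : 𝔸) = algebraMap ℝ 𝔸 k⁻¹ := rfl
  have hu' : ((u⁻¹ : 𝔸ˣ) : 𝔸) = algebraMap ℝ 𝔸 k := by
    change algebraMap ℝ 𝔸 (k⁻¹)⁻¹ = _
    rw [inv_inv]
  have hu0 : 0 ≤ (u : 𝔸) := by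
    rw [hu]; exact algebraMap_nonneg 𝔸 (by positivity)
  have hS : IsUnit S := CStarAlgebra.isUnit_of_le (u : 𝔸) h (u.isUnit.isStrictlyPositive hu0)
  obtain ⟨v, rfl⟩ := hS
  refine ⟨(v⁻¹ : 𝔸ˣ), v.inv_mul, v.mul_inv, ?_⟩
  have hle := CStarAlgebra.inv_le_inv hu0 h
  rw [hu'] at hle
  have hv0 : 0 ≤ ((v⁻¹ : 𝔸ˣ) : 𝔸) := by
    have hv : (0 : 𝔸) ≤ v := hu0.trans h
    have := star_left_conjugate_nonneg hv ((v⁻¹ : 𝔸ˣ) : 𝔸)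
    have hs : star ((v⁻¹ : 𝔸ˣ) : 𝔸) = ((v⁻¹ : 𝔸ˣ) : 𝔸) := by
      have : star v = v := Units.ext (IsSelfAdjoint.of_nonneg hv).star_eq
      rw [← Units.coe_star, star_inv, this]
    rwa [hs, v.inv_mul, one_mul] at this
  exact (CStarAlgebra.norm_le_iff_le_algebraMap _ hk.le hv0).2 hle

end Kraus

/-! ### Perturbation of products. -/

section Approximation

variable {𝔸 : Type*} [CStarAlgebra 𝔸]

theorem norm_mul_sub_mul_le {a a' b b' : 𝔸} {A B x y : ℝ} (ha : ‖a‖ ≤ A) (hb : ‖b'‖ ≤ B)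
    (hx : ‖a - a'‖ ≤ x) (hy : ‖b - b'‖ ≤ y) : ‖a * b - a' * b'‖ ≤ A * y + x * B := by
  have : a * b - a' * b' = a * (b - b') + (a - a') * b' := by noncomm_ring
  rw [this]
  have hA := (norm_nonneg _).trans ha
  have hx0 := (norm_nonneg _).trans hx
  exact (norm_add_le _ _).trans (add_le_add ((norm_mul_le _ _).trans (by gcongr))
    ((norm_mul_le _ _).trans (by gcongr)))

theorem norm_mul_le_of_le' {a b : 𝔸} {A B : ℝ} (ha : ‖a‖ ≤ A) (hb : ‖b‖ ≤ B) :
    ‖a * b‖ ≤ A * B :=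
  (norm_mul_le _ _).trans (mul_le_mul ha hb (norm_nonneg _) ((norm_nonneg _).trans ha))

theorem norm_mul_five_sub_le {a b c d e a' b' c' d' e' : 𝔸} {L δ : ℝ}
    (ha : ‖a‖ ≤ L) (hb : ‖b‖ ≤ L) (hc : ‖c‖ ≤ L) (hd : ‖d‖ ≤ L)
    (hb' : ‖b'‖ ≤ L) (hc' : ‖c'‖ ≤ L) (hd' : ‖d'‖ ≤ L) (he' : ‖e'‖ ≤ L)
    (xa : ‖a - a'‖ ≤ δ) (xb : ‖b - b'‖ ≤ δ) (xc : ‖c - c'‖ ≤ δ) (xd : ‖d - d'‖ ≤ δ)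
    (xe : ‖e - e'‖ ≤ δ) :
    ‖a * b * c * d * e - a' * b' * c' * d' * e'‖ ≤ 5 * L ^ 4 * δ := by
  have n2 := norm_mul_le_of_le' ha hb
  have n3 := norm_mul_le_of_le' n2 hc
  have n4 := norm_mul_le_of_le' n3 hd
  have h2 := norm_mul_sub_mul_le ha hb' xa xb
  have h3 := norm_mul_sub_mul_le n2 hc' h2 xc
  have h4 := norm_mul_sub_mul_le n3 hd' h3 xd
  have h5 := norm_mul_sub_mul_le n4 he' h4 xe
  refine h5.trans (le_of_eq (by ring))

end Approximation

/-! ### The approximate Markov property in operator norm. -/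

section Markov

variable {𝔸 : Type*} [CStarAlgebra 𝔸] [PartialOrder 𝔸] [StarOrderedRing 𝔸]
  {ι κ : Type*} [Fintype ι] [Fintype κ]

theorem norm_kraus_star_mul_sub_le [NormOneClass 𝔸] {V : ι → 𝔸} (hV : kraus V 1 = 1) {F Y : 𝔸} {K η : ℝ}
    (hF : ‖F‖ ≤ K) (hY : ‖Y‖ ≤ K) (h : ‖F - Y‖ ≤ η) :
    ‖kraus V (star F * F) - kraus V (star Y * Y)‖ ≤ 6 * K * η := by
  rw [← kraus_sub]
  refine (norm_kraus_le hV ((IsSelfAdjoint.star_mul_self F).sub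
    (IsSelfAdjoint.star_mul_self Y))).trans ?_
  have := norm_mul_sub_mul_le (a := star F) (a' := star Y) (b := F) (b' := Y) (A := K) (x := η)
    (by rwa [norm_star]) hY (by rwa [← star_sub, norm_star]) h
  linarith

theorem norm_kraus_star_mul_le {V : ι → 𝔸} (hV : kraus V 1 = 1) {F : 𝔸} {K : ℝ}
    (hF : ‖F‖ ≤ K) : ‖kraus V (star F * F)‖ ≤ K ^ 2 := by
  refine (norm_kraus_le_of_nonneg hV (star_mul_self_nonneg F)).trans ?_
  rw [CStarRing.norm_star_mul_self, ← sq]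
  gcongr

theorem exists_inverse_kraus {V : ι → 𝔸} (hV : kraus V 1 = 1) {F F' : 𝔸} {K : ℝ} (hK : 0 < K)
    (hF : F' * F = 1) (hn : ‖F'‖ ≤ K) :
    ∃ R, R * kraus V (star F * F) = 1 ∧ kraus V (star F * F) * R = 1 ∧ ‖R‖ ≤ K ^ 2 := by
  refine exists_inverse_of_algebraMap_le (by positivity) ?_
  rw [← kraus_algebraMap hV]
  exact kraus_mono V (algebraMap_le_star_mul_self hK hF hn)

/-- The approximate Markov property in terms of operator norms: the conditional expectations
`kraus VA`, `kraus VC` of the products of almost local operators nearly factorize. -/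
theorem norm_markov_defect_le [NormOneClass 𝔸] {VA : ι → 𝔸} {VC : κ → 𝔸} (hVA : kraus VA 1 = 1)
    (hVC : kraus VC 1 = 1) {X Y E E' FA FC X' Y' FA' E'' : 𝔸} {K η : ℝ} (hK : 1 ≤ K)
    (nX : ‖X‖ ≤ K) (nY : ‖Y‖ ≤ K) (nE : ‖E‖ ≤ K) (nE' : ‖E'‖ ≤ K) (nFA : ‖FA‖ ≤ K)
    (nFC : ‖FC‖ ≤ K) (nX' : ‖X'‖ ≤ K) (nY' : ‖Y'‖ ≤ K) (nFA' : ‖FA'‖ ≤ K) (nE'' : ‖E''‖ ≤ K)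
    (iX : X' * X = 1) (iY : Y' * Y = 1) (iFA : FA' * FA = 1) (iE' : E'' * E' = 1)
    (xE : ‖E - X‖ ≤ η) (xE' : ‖E' - Y‖ ≤ η) (xFA : ‖FA - X‖ ≤ η) (xFC : ‖FC - Y‖ ≤ η)
    (cXY : Commute X Y) (cXY' : Commute X (star Y))
    (cX : ∀ i, Commute X (VC i)) (cX' : ∀ i, Commute X (star (VC i)))
    (cY : ∀ i, Commute Y (VA i)) (cY' : ∀ i, Commute Y (star (VA i)))
    (cV : ∀ i j, Commute (VA i) (VC j)) (cV' : ∀ i j, Commute (VA i) (star (VC j))) :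
    ∃ R, R * kraus VA (kraus VC (star (FA * E') * (FA * E'))) = 1 ∧
      kraus VA (kraus VC (star (FA * E') * (FA * E'))) * R = 1 ∧
      ‖star FC * FA - kraus VC (star FC * FC) * E * R * star E' * kraus VA (star FA * FA)‖
        ≤ 182 * K ^ 27 * η := by
  have hη : 0 ≤ η := (norm_nonneg _).trans xE
  have hK0 : 0 < K := by linarith
  set S := kraus VC (star FC * FC)
  set S' := kraus VA (star FA * FA)
  set s := kraus VC (star Y * Y) with hs
  set s' := kraus VA (star X * X) with hs'
  set M := kraus VA (kraus VC (star (FA * E') * (FA * E'))) with hM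
  have cX₂ : ∀ i, Commute (star X) (VC i) := fun i => by
    simpa using (cX' i).star_star
  have cX₂' : ∀ i, Commute (star X) (star (VC i)) := fun i => (cX i).star_star
  have cY₂ : ∀ i, Commute (star Y) (VA i) := fun i => by
    simpa using (cY' i).star_star
  have cY₂' : ∀ i, Commute (star Y) (star (VA i)) := fun i => (cY i).star_star
  have cXY₂ : Commute (star X) Y := by simpa using cXY'.star_star
  have cXY₂' : Commute (star X) (star Y) := cXY.star_star
  have cV₂ : ∀ i j, Commute (star (VA i)) (VC j) := fun i j => by
    simpa using (cV' i j).star_star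
  have cV₂' : ∀ i j, Commute (star (VA i)) (star (VC j)) := fun i j => (cV i j).star_star
  have csX : Commute X s := commute_kraus cX cX' (cXY'.mul_right cXY)
  have csV : ∀ i, Commute s (VA i) := fun i =>
    (commute_kraus (cV i) (cV' i) ((cY₂ i).symm.mul_right (cY i).symm)).symm
  have csV' : ∀ i, Commute s (star (VA i)) := fun i =>
    (commute_kraus (cV₂ i) (cV₂' i) ((cY₂' i).symm.mul_right (cY' i).symm)).symm
  have cYs' : Commute (star Y) s' :=
    commute_kraus cY₂ cY₂' (cXY₂'.symm.mul_right cXY'.symm)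
  -- the factorization of the local version of `M`
  have hfac : kraus VA (kraus VC (star (X * Y) * (X * Y))) = s' * s := by
    have e : star (X * Y) * (X * Y) = star X * X * (star Y * Y) := by
      rw [star_mul]
      calc star Y * star X * (X * Y) = (star Y * star X) * X * Y := by simp only [mul_assoc]
        _ = star X * (star Y * X) * Y := by rw [← cXY₂'.eq]; simp only [mul_assoc]
        _ = _ := by rw [← cXY'.eq]; simp only [mul_assoc]
    rw [e, kraus_mul_left (fun i => (cX₂ i).mul_left (cX i)),
      kraus_mul_right csV', hs']
  -- bounds
  have nS : ‖S‖ ≤ K ^ 2 := norm_kraus_star_mul_le hVC nFC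
  have ns' : ‖s'‖ ≤ K ^ 2 := norm_kraus_star_mul_le hVA nX
  have xS : ‖S - s‖ ≤ 6 * K * η := norm_kraus_star_mul_sub_le hVC nFC nY xFC
  have xS' : ‖S' - s'‖ ≤ 6 * K * η := norm_kraus_star_mul_sub_le hVA nFA nX xFA
  obtain ⟨t, ht1, ht2, nt⟩ := exists_inverse_kraus hVC hK0 iY nY'
  obtain ⟨t', ht'1, ht'2, nt'⟩ := exists_inverse_kraus hVA hK0 iX nX'
  rw [← hs] at ht1 ht2
  rw [← hs'] at ht'1 ht'2
  have iT : E'' * FA' * (FA * E') = 1 := by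
    calc E'' * FA' * (FA * E') = E'' * (FA' * FA) * E' := by simp only [mul_assoc]
      _ = 1 := by rw [iFA, mul_one, iE']
  have nT' : ‖E'' * FA'‖ ≤ K ^ 2 := (norm_mul_le_of_le' nE'' nFA').trans (by rw [sq])
  have nT : ‖FA * E'‖ ≤ K ^ 2 := (norm_mul_le_of_le' nFA nE').trans (by rw [sq])
  have nXY : ‖X * Y‖ ≤ K ^ 2 := (norm_mul_le_of_le' nX nY).trans (by rw [sq])
  obtain ⟨R, hR1, hR2, nR⟩ : ∃ R, R * M = 1 ∧ M * R = 1 ∧ ‖R‖ ≤ (K ^ 2) ^ 2 := by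
    refine exists_inverse_of_algebraMap_le (by positivity) ?_
    rw [hM, ← kraus_algebraMap hVA, ← kraus_algebraMap hVC]
    exact kraus_mono _ (kraus_mono _ (algebraMap_le_star_mul_self (by positivity) iT nT'))
  have xT : ‖FA * E' - X * Y‖ ≤ 2 * K * η :=
    (norm_mul_sub_mul_le nFA nY xFA xE').trans (le_of_eq (by ring))
  have xM : ‖M - s' * s‖ ≤ 36 * K ^ 3 * η := by
    rw [← hfac, hM, ← kraus_sub]
    have sa : IsSelfAdjoint (kraus VC (star (FA * E') * (FA * E')) -
        kraus VC (star (X * Y) * (X * Y))) := by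
      rw [IsSelfAdjoint, star_sub, star_kraus, star_kraus]
      simp only [star_mul, star_star]
    refine (norm_kraus_le hVA sa).trans ?_
    have := norm_kraus_star_mul_sub_le hVC nT nXY xT
    calc _ ≤ 3 * (6 * K ^ 2 * (2 * K * η)) := by gcongr
      _ = _ := by ring
  have hq : s' * s * (t * t') = 1 := by
    calc s' * s * (t * t') = s' * (s * t) * t' := by simp only [mul_assoc]
      _ = 1 := by rw [ht2, mul_one, ht'2]
  have nq : ‖t * t'‖ ≤ K ^ 4 := (norm_mul_le_of_le' nt nt').trans (le_of_eq (by ring))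
  have nR4 : ‖R‖ ≤ K ^ 4 := nR.trans (le_of_eq (by ring))
  have xR : ‖R - t * t'‖ ≤ 36 * K ^ 11 * η := by
    -- Resolvent identity: closeness of M to s' s passes to the inverses.
    have e : R - t * t' = R * (s' * s - M) * (t * t') := by
      rw [mul_sub, sub_mul, hR1, one_mul, mul_assoc, hq, mul_one]
    rw [e]
    rw [norm_sub_rev] at xM
    exact (norm_mul_le_of_le' (norm_mul_le_of_le' nR4 xM) nq).trans (le_of_eq (by ring))
  -- The exact cancellation: s commutes with X and s' with Y*, so both meet their inverses.
  have hlocal : s * X * (t * t') * star Y * s' = X * star Y := by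
    calc s * X * (t * t') * star Y * s' = s * X * t * t' * (star Y * s') := by
          simp only [mul_assoc]
      _ = X * (s * t) * (t' * s') * star Y := by
          rw [cYs'.eq, ← csX.eq]; simp only [mul_assoc]
      _ = _ := by rw [ht2, ht'1, mul_one, mul_one]
  refine ⟨R, hR1, hR2, ?_⟩
  have p : ∀ {i j : ℕ}, i ≤ j → K ^ i ≤ K ^ j := fun h => pow_le_pow_right₀ hK h
  have pK : K ≤ K ^ 4 := by simpa using p (show 1 ≤ 4 by norm_num)
  have p11 : 1 ≤ K ^ 11 := one_le_pow₀ hK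
  have hδ1 : η ≤ 36 * K ^ 11 * η := by nlinarith
  have hδ2 : 6 * K * η ≤ 36 * K ^ 11 * η := by
    have : K ≤ K ^ 11 := by simpa using p (show 1 ≤ 11 by norm_num)
    gcongr
    norm_num
  -- The worst of the five factors is R, for both the size and the error; its bounds serve for all.
  have main := norm_mul_five_sub_le (L := K ^ 4) (δ := 36 * K ^ 11 * η)
    (nS.trans (p (by norm_num))) (nE.trans pK) nR4 (d := star E')
    (by rw [norm_star]; exact nE'.trans pK) (nX.trans pK) nq (d' := star Y)
    (by rw [norm_star]; exact nY.trans pK) (ns'.trans (p (by norm_num)))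
    (xS.trans hδ2) (xE.trans hδ1) xR (by rw [← star_sub, norm_star]; exact xE'.trans hδ1)
    (xS'.trans hδ2)
  rw [hlocal] at main
  have first : ‖star FC * FA - X * star Y‖ ≤ 2 * K * η := by
    rw [cXY'.eq]
    exact (norm_mul_sub_mul_le (A := K) (x := η) (by rwa [norm_star]) nX (by rwa [← star_sub, norm_star])
      xFA).trans (le_of_eq (by ring))
  have p27 : K ≤ K ^ 27 := by simpa using p (show 1 ≤ 27 by norm_num)
  calc _ = ‖(star FC * FA - X * star Y) - (S * E * R * star E' * S' - X * star Y)‖ := by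
        rw [sub_sub_sub_cancel_right]
    _ ≤ 2 * K * η + 5 * (K ^ 4) ^ 4 * (36 * K ^ 11 * η) :=
        (norm_sub_le _ _).trans (add_le_add first main)
    _ = 2 * K * η + 180 * K ^ 27 * η := by ring
    _ ≤ 2 * K ^ 27 * η + 180 * K ^ 27 * η := by gcongr
    _ = _ := by ring

end Markov

/-! ### Embeddings of local algebras, and partial traces as Kraus maps. -/

section Embedding

open scoped Kronecker Matrix.Norms.L2Operator

variable {d : ℕ} {Λ I : Finset ℤ}

/-- A configuration on `I` is a configuration on `Λ` together with one on `I \ Λ`. -/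
def configEquiv (h : Λ ⊆ I) : Config d I ≃ Config d Λ × Config d (I \ Λ) where
  toFun σ := (restrict h σ, restrict Finset.sdiff_subset σ)
  invFun p := glue p.1 p.2
  left_inv σ := by
    funext x
    simp only [glue, restrict]
    split <;> rfl
  right_inv p := by
    refine Prod.ext ?_ ?_ <;> funext x <;> simp only [glue, restrict]
    · rw [dif_pos x.2]
    · rw [dif_neg (Finset.mem_sdiff.1 x.2).2]

theorem embed_eq_submatrix (h : Λ ⊆ I) (Q : Obs d Λ) :
    embed h Q = (Q ⊗ₖ (1 : Obs d (I \ Λ))).submatrix (configEquiv h) (configEquiv h) := by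
  ext σ τ
  simp only [embed, Matrix.of_apply, Matrix.submatrix_apply, Matrix.kroneckerMap_apply,
    configEquiv, Equiv.coe_fn_mk, Matrix.one_apply, mul_ite, mul_one, mul_zero]

/-- The embedding `𝔄_Λ → 𝔄_I` as a homomorphism of `*`-algebras. -/
def embedHom (h : Λ ⊆ I) : Obs d Λ →⋆ₐ[ℂ] Obs d I where
  toFun := embed h
  map_one' := by
    rw [embed_eq_submatrix, Matrix.one_kronecker_one, Matrix.submatrix_one_equiv]
  map_mul' P Q := by
    rw [embed_eq_submatrix, embed_eq_submatrix, embed_eq_submatrix, Matrix.submatrix_mul_equiv,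
      ← Matrix.mul_kronecker_mul, one_mul]
  map_zero' := by
    rw [embed_eq_submatrix, Matrix.zero_kronecker, Matrix.submatrix_zero]; rfl
  map_add' P Q := by
    rw [embed_eq_submatrix, embed_eq_submatrix, embed_eq_submatrix, Matrix.add_kronecker]
    rfl
  commutes' c := by
    rw [embed_eq_submatrix, Algebra.algebraMap_eq_smul_one, Matrix.smul_kronecker,
      Matrix.one_kronecker_one, Algebra.algebraMap_eq_smul_one]
    rw [← Matrix.submatrix_one_equiv (configEquiv (d := d) h)]
    rfl
  map_star' Q := by
    rw [embed_eq_submatrix, embed_eq_submatrix, Matrix.star_eq_conjTranspose,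
      Matrix.star_eq_conjTranspose, Matrix.conjTranspose_submatrix,
      Matrix.conjTranspose_kronecker, Matrix.conjTranspose_one]

theorem embedHom_apply (h : Λ ⊆ I) (Q : Obs d Λ) : embedHom h Q = embed h Q := rfl

theorem embed_apply (h : Λ ⊆ I) (Q : Obs d Λ) (σ τ : Config d I) :
    embed h Q σ τ = if ∀ x : I, (x : ℤ) ∉ Λ → σ x = τ x
      then Q (restrict h σ) (restrict h τ) else 0 := by
  simp only [embed, Matrix.of_apply]
  refine if_congr ⟨fun hc x hx => ?_, fun hc => ?_⟩ rfl rfl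
  · exact congrFun hc ⟨x, Finset.mem_sdiff.2 ⟨x.2, hx⟩⟩
  · funext x
    exact hc ⟨x, (Finset.mem_sdiff.1 x.2).1⟩ (Finset.mem_sdiff.1 x.2).2

theorem embed_embed {Λ' : Finset ℤ} (h : Λ ⊆ Λ') (h' : Λ' ⊆ I) (Q : Obs d Λ) :
    embed h' (embed h Q) = embed (h.trans h') Q := by
  ext σ τ
  rw [embed_apply, embed_apply, embed_apply, ← ite_and]
  refine if_congr ⟨fun hc x hx => ?_, fun hc => ⟨fun x hx => hc x fun hxΛ => hx (h hxΛ),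
    fun x hx => hc ⟨x, h' x.2⟩ hx⟩⟩ rfl rfl
  by_cases hx' : (x : ℤ) ∈ Λ'
  · exact hc.2 ⟨x, hx'⟩ hx
  · exact hc.1 x hx'

theorem continuous_embedHom (h : Λ ⊆ I) : Continuous (embedHom (d := d) h) :=
  (embedHom (d := d) h).toLinearMap.continuous_of_finiteDimensional

theorem embed_exp (h : Λ ⊆ I) (Q : Obs d Λ) :
    embed h (NormedSpace.exp Q) = NormedSpace.exp (embed h Q) := by
  let _ : NormedAlgebra ℚ (Obs d Λ) := NormedAlgebra.restrictScalars ℚ ℂ _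
  exact NormedSpace.map_exp (embedHom (d := d) h) (continuous_embedHom h) Q

theorem norm_embed_le (h : Λ ⊆ I) (Q : Obs d Λ) : ‖embed h Q‖ ≤ ‖Q‖ :=
  NonUnitalStarAlgHom.norm_apply_le (embedHom (d := d) h) Q

theorem embed_mul_embed_apply {Λ₁ Λ₂ : Finset ℤ} (h₁ : Λ₁ ⊆ I) (h₂ : Λ₂ ⊆ I)
    (hd : Disjoint Λ₁ Λ₂) (P : Obs d Λ₁) (Q : Obs d Λ₂) (σ τ : Config d I) :
    (embed h₁ P * embed h₂ Q) σ τ = if ∀ x : I, (x : ℤ) ∉ Λ₁ → (x : ℤ) ∉ Λ₂ → σ x = τ x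
      then P (restrict h₁ σ) (restrict h₁ τ) * Q (restrict h₂ σ) (restrict h₂ τ) else 0 := by
  rw [Matrix.mul_apply]
  -- The only intermediate configuration that contributes: it must agree with σ off Λ₁ and with τ
  -- off Λ₂. The resulting entry is symmetric in the two factors, which yields `commute_embed`.
  let υ : Config d I := fun x => if (x : ℤ) ∈ Λ₁ then τ x else σ x
  have hυ₁ : restrict h₁ υ = restrict h₁ τ := by
    funext x
    simp only [restrict, υ]
    rw [if_pos x.2]
  have hυ₂ : restrict h₂ υ = restrict h₂ σ := by
    funext x
    simp only [restrict, υ]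
    rw [if_neg (Finset.disjoint_right.1 hd x.2)]
  rw [Finset.sum_eq_single υ]
  · rw [embed_apply, embed_apply, hυ₁, hυ₂, if_pos, mul_ite, mul_zero]
    · refine if_congr ⟨fun hc x hx₁ hx₂ => ?_, fun hc x hx₂ => ?_⟩ rfl rfl
      · have := hc x hx₂
        simp only [υ] at this
        rwa [if_neg hx₁] at this
      · simp only [υ]
        split
        · rfl
        · exact hc x ‹_› hx₂
    · intro x hx
      simp only [υ]
      rw [if_neg hx]
  · intro w _ hw
    rw [embed_apply, embed_apply]
    by_contra hne
    have h1 := left_ne_zero_of_mul hne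
    have h2 := right_ne_zero_of_mul hne
    rw [ne_eq, ite_eq_right_iff, Classical.not_imp] at h1 h2
    refine hw (funext fun x => ?_)
    simp only [υ]
    split
    · exact h2.1 x (Finset.disjoint_left.1 hd ‹_›)
    · exact (h1.1 x ‹_›).symm
  · exact fun hn => (hn (Finset.mem_univ _)).elim

theorem commute_embed {Λ₁ Λ₂ : Finset ℤ} (h₁ : Λ₁ ⊆ I) (h₂ : Λ₂ ⊆ I)
    (hd : Disjoint Λ₁ Λ₂) (P : Obs d Λ₁) (Q : Obs d Λ₂) :
    Commute (embed h₁ P) (embed h₂ Q) := by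
  refine Matrix.ext fun σ τ => ?_
  rw [embed_mul_embed_apply h₁ h₂ hd, embed_mul_embed_apply h₂ h₁ hd.symm]
  exact if_congr ⟨fun hc x h2 h1 => hc x h1 h2, fun hc x h2 h1 => hc x h1 h2⟩
    (mul_comm _ _) rfl

/-- The configuration `σ` with its values on `C` replaced by `j`. -/
def put {C : Finset ℤ} (j : Config d C) (σ : Config d I) : Config d I :=
  fun x => if hx : (x : ℤ) ∈ C then j ⟨x, hx⟩ else σ x

theorem restrict_put {C : Finset ℤ} (h : C ⊆ I) (j : Config d C) (σ : Config d I) :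
    restrict h (put j σ) = j := by
  funext x
  simp only [restrict, put]
  rw [dif_pos x.2]

theorem restrict_put_of_disjoint {A C : Finset ℤ} (h : C ⊆ I) (hd : Disjoint A C)
    (j : Config d A) (σ : Config d I) : restrict h (put j σ) = restrict h σ := by
  funext x
  simp only [restrict, put]
  rw [dif_neg (Finset.disjoint_right.1 hd x.2)]

/-- The matrix units of `𝔄_C`, embedded in `𝔄_I`. -/
def matUnit {C : Finset ℤ} (h : C ⊆ I) (p : Config d C × Config d C) : Obs d I :=
  embed h (Matrix.single p.1 p.2 1)

theorem matUnit_mul_apply {C : Finset ℤ} (h : C ⊆ I) (i j : Config d C) (Q : Obs d I)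
    (σ τ : Config d I) :
    (matUnit h (i, j) * Q) σ τ = if restrict h σ = i then Q (put j σ) τ else 0 := by
  rw [Matrix.mul_apply, Finset.sum_eq_single (put j σ)]
  · rw [matUnit, embed_apply, if_pos, restrict_put, Matrix.single_apply]
    · by_cases hc : restrict h σ = i
      · rw [if_pos hc, if_pos ⟨hc.symm, rfl⟩, one_mul]
      · rw [if_neg hc, if_neg fun hh => hc hh.1.symm, zero_mul]
    · intro x hx
      simp only [put]
      rw [dif_neg hx]
  · intro w _ hw
    rw [matUnit, embed_apply]
    by_contra hne
    have h1 := left_ne_zero_of_mul hne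
    rw [ne_eq, ite_eq_right_iff, Classical.not_imp] at h1
    obtain ⟨h1, h2⟩ := h1
    rw [Matrix.single_apply, ite_eq_right_iff, Classical.not_imp] at h2
    refine hw (funext fun x => ?_)
    simp only [put]
    split
    · exact (congrFun h2.1.2 ⟨x, ‹_›⟩).symm
    · exact (h1 x ‹_›).symm
  · exact fun hn => (hn (Finset.mem_univ _)).elim

theorem mul_star_matUnit_apply {C : Finset ℤ} (h : C ⊆ I) (i j : Config d C) (Q : Obs d I)
    (σ τ : Config d I) :
    (Q * star (matUnit h (i, j))) σ τ = if restrict h τ = i then Q σ (put j τ) else 0 := by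
  have e : Q * star (matUnit h (i, j)) = star (matUnit h (i, j) * star Q) := by
    rw [star_mul, star_star]
  rw [e, Matrix.star_apply, matUnit_mul_apply]
  split
  · rw [Matrix.star_apply, star_star]
  · exact star_zero _

/-- For a matrix unit e_{ij}, the index i rebuilds the identity on C and j performs the trace over
C. This makes the partial trace a Kraus map, see `reduced_eq_kraus`. -/
theorem kraus_matUnit_apply {C : Finset ℤ} (h : C ⊆ I) (Q : Obs d I) (σ τ : Config d I) :
    kraus (matUnit h) Q σ τ = if restrict h σ = restrict h τ
      then ∑ j : Config d C, Q (put j σ) (put j τ) else 0 := by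
  rw [kraus, Fintype.sum_prod_type, Matrix.sum_apply]
  simp only [Matrix.sum_apply, mul_star_matUnit_apply, matUnit_mul_apply]
  rw [Finset.sum_eq_single (restrict h τ)]
  · by_cases hc : restrict h σ = restrict h τ <;> simp [hc]
  · intro i _ hi
    simp [hi.symm]
  · exact fun hn => (hn (Finset.mem_univ _)).elim

theorem reduced_eq_kraus {C : Finset ℤ} (h : Λ ⊆ I) (hC : C ⊆ I) (e : I \ Λ = C) (Q : Obs d I) :
    reduced h Q = kraus (matUnit hC) Q := by
  subst e
  ext σ τ
  rw [kraus_matUnit_apply, reduced, embed, Matrix.of_apply, partialTrace]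
  simp only [Matrix.of_apply]
  have hg : ∀ (σ : Config d I) (ω : Config d (I \ Λ)), glue (restrict h σ) ω = put ω σ := by
    intro σ ω
    funext x
    simp only [glue, put, restrict]
    by_cases hx : (x : ℤ) ∈ Λ
    · rw [dif_pos hx, dif_neg fun hh => (Finset.mem_sdiff.1 hh).2 hx]
    · rw [dif_neg hx, dif_pos (Finset.mem_sdiff.2 ⟨x.2, hx⟩)]
  simp only [hg]

theorem kraus_matUnit_union {A C : Finset ℤ} (hA : A ⊆ I) (hC : C ⊆ I) (hd : Disjoint A C)
    (Q : Obs d I) :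
    kraus (matUnit (Finset.union_subset hA hC)) Q
      = kraus (matUnit hA) (kraus (matUnit hC) Q) := by
  ext σ τ
  simp only [kraus_matUnit_apply, restrict_put_of_disjoint hC hd]
  have hcond : restrict (Finset.union_subset hA hC) σ = restrict (Finset.union_subset hA hC) τ ↔
      restrict hA σ = restrict hA τ ∧ restrict hC σ = restrict hC τ := by
    refine ⟨fun hc => ⟨?_, ?_⟩, fun hc => ?_⟩
    · funext x; exact congrFun hc ⟨x, Finset.mem_union_left _ x.2⟩
    · funext x; exact congrFun hc ⟨x, Finset.mem_union_right _ x.2⟩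
    · funext x
      rcases Finset.mem_union.1 x.2 with hx | hx
      · exact congrFun hc.1 ⟨x, hx⟩
      · exact congrFun hc.2 ⟨x, hx⟩
  by_cases h1 : restrict hA σ = restrict hA τ
  swap
  · rw [if_neg h1, if_neg fun hh => h1 (hcond.1 hh).1]
  by_cases h2 : restrict hC σ = restrict hC τ
  swap
  · rw [if_neg fun hh => h2 (hcond.1 hh).2]
    simp [h2]
  rw [if_pos (hcond.2 ⟨h1, h2⟩), if_pos h1]
  simp only [if_pos h2]
  rw [← Fintype.sum_prod_type' (f := fun jA jC => Q (put jC (put jA σ)) (put jC (put jA τ)))]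
  have hput : ∀ (j : Config d (A ∪ C)) (σ : Config d I),
      put (restrict Finset.subset_union_right j) (put (restrict Finset.subset_union_left j) σ)
        = put j σ := by
    intro j σ
    funext x
    simp only [put, restrict, Finset.mem_union]
    by_cases hxC : (x : ℤ) ∈ C
    · simp [hxC]
    · by_cases hxA : (x : ℤ) ∈ A
      · simp [hxC, hxA]
      · simp [hxC, hxA]
  refine Fintype.sum_equiv
    { toFun := fun j => (restrict Finset.subset_union_left j, restrict Finset.subset_union_right j)
      invFun := fun p => fun x => if hx : (x : ℤ) ∈ A then p.1 ⟨x, hx⟩ else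
        p.2 ⟨x, (Finset.mem_union.1 x.2).resolve_left hx⟩
      left_inv := fun j => by
        funext x
        simp only [restrict]
        split <;> rfl
      right_inv := fun p => by
        refine Prod.ext ?_ ?_ <;> funext x <;> simp only [restrict]
        · rw [dif_pos x.2]
        · rw [dif_neg (Finset.disjoint_right.1 hd x.2)] } _ _ fun j => ?_
  simp only [Equiv.coe_fn_mk, hput]

theorem kraus_matUnit_embed {C : Finset ℤ} (h : C ⊆ I) (Q : Obs d C) :
    kraus (matUnit h) (embed h Q) = Q.trace • (1 : Obs d I) := by
  ext σ τ
  rw [kraus_matUnit_apply]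
  simp only [embed_apply, restrict_put]
  have hcond : ∀ j : Config d C, (∀ x : I, (x : ℤ) ∉ C → put j σ x = put j τ x) ↔
      ∀ x : I, (x : ℤ) ∉ C → σ x = τ x := by
    intro j
    refine forall₂_congr fun x hx => ?_
    simp only [put]
    rw [dif_neg hx, dif_neg hx]
  simp only [hcond, Matrix.smul_apply, Matrix.one_apply]
  by_cases hστ : σ = τ
  · subst hστ
    simp [Matrix.trace]
  · rw [if_neg hστ, smul_zero]
    split
    · rename_i hc
      have hf : ¬ ∀ x : I, (x : ℤ) ∉ C → σ x = τ x := by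
        intro hx
        refine hστ (funext fun x => ?_)
        by_cases hxC : (x : ℤ) ∈ C
        · exact congrFun hc ⟨x, hxC⟩
        · exact hx x hxC
      simp only [if_neg hf, Finset.sum_const_zero]
    · rfl

end Embedding

/-! ### Hilbert-Schmidt norm, trace norm and Hölder's inequality. -/

section TraceNorm

open scoped Matrix.Norms.L2Operator MatrixOrder ComplexOrder

variable {n : Type*} [Fintype n]

/-- The square of the Hilbert-Schmidt norm. -/
def hsSq (X : Matrix n n ℂ) : ℝ := (Matrix.trace (Xᴴ * X)).re

theorem hsSq_nonneg (X : Matrix n n ℂ) : 0 ≤ hsSq X :=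
  (Complex.le_def.1 (Matrix.posSemidef_conjTranspose_mul_self X).trace_nonneg).1

theorem hsSq_conjTranspose (X : Matrix n n ℂ) : hsSq Xᴴ = hsSq X := by
  rw [hsSq, hsSq, Matrix.conjTranspose_conjTranspose, Matrix.trace_mul_comm]

variable [DecidableEq n]

theorem hsSq_mul_le (D Y : Matrix n n ℂ) : hsSq (D * Y) ≤ ‖D‖ ^ 2 * hsSq Y := by
  have h1 : star D * D ≤ algebraMap ℝ _ (‖D‖ ^ 2) := CStarAlgebra.star_mul_le_algebraMap_norm_sq
  have h2 := star_left_conjugate_le_conjugate h1 Y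
  have h3 := (Complex.le_def.1 (Matrix.PosSemidef.trace_nonneg (Matrix.le_iff.1 h2))).1
  rw [Matrix.trace_sub, Complex.sub_re, Complex.zero_re, sub_nonneg] at h3
  have e1 : star Y * (star D * D) * Y = (D * Y)ᴴ * (D * Y) := by
    rw [Matrix.conjTranspose_mul]
    simp only [Matrix.star_eq_conjTranspose, mul_assoc]
  have e2 : star Y * algebraMap ℝ _ (‖D‖ ^ 2) * Y = (‖D‖ ^ 2) • (Yᴴ * Y) := by
    rw [Algebra.algebraMap_eq_smul_one, mul_smul_comm, smul_mul_assoc, mul_one]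
    rfl
  rw [e1, e2, Matrix.trace_smul, Complex.real_smul, Complex.re_ofReal_mul] at h3
  exact h3

theorem hsSq_mul_le' (Y D : Matrix n n ℂ) : hsSq (Y * D) ≤ ‖D‖ ^ 2 * hsSq Y := by
  rw [← hsSq_conjTranspose (Y * D), Matrix.conjTranspose_mul, ← hsSq_conjTranspose Y]
  refine (hsSq_mul_le _ _).trans ?_
  rw [Matrix.l2_opNorm_conjTranspose]

/-- Expand the square of the Hilbert-Schmidt norm of tA - B; this weighted form replaces the
Cauchy-Schwarz inequality. -/
theorem two_mul_re_trace_le (A B : Matrix n n ℂ) (t : ℝ) :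
    2 * t * (Matrix.trace (Aᴴ * B)).re ≤ t ^ 2 * hsSq A + hsSq B := by
  have h := hsSq_nonneg (t • A - B)
  have e : (Matrix.trace (Bᴴ * A)).re = (Matrix.trace (Aᴴ * B)).re := by
    have : Bᴴ * A = (Aᴴ * B)ᴴ := by
      rw [Matrix.conjTranspose_mul, Matrix.conjTranspose_conjTranspose]
    rw [this, Matrix.trace_conjTranspose, Complex.star_def, Complex.conj_re]
  have hx : hsSq (t • A - B) = t ^ 2 * hsSq A - t * (Matrix.trace (Aᴴ * B)).re
      - t * (Matrix.trace (Bᴴ * A)).re + hsSq B := by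
    simp only [hsSq, Matrix.conjTranspose_sub, Matrix.conjTranspose_smul, star_trivial, sub_mul,
      mul_sub, smul_mul_assoc, mul_smul_comm, Matrix.trace_sub, Matrix.trace_smul, Complex.sub_re,
      Complex.real_smul, Complex.re_ofReal_mul]
    ring
  rw [hx, e] at h
  linarith

/-- Singular value decomposition: V diagonalizes Q* Q, and W = Q V T collects the normalized left
singular vectors. -/
theorem exists_traceNorm_eq {d : ℕ} {Λ : Finset ℤ} (Q : Obs d Λ) :
    ∃ W V : Obs d Λ, ‖W‖ ≤ 1 ∧ ‖V‖ ≤ 1 ∧ traceNorm Q = (Matrix.trace (Wᴴ * Q * V)).re := by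
  set hQ := Matrix.isHermitian_conjTranspose_mul_self Q with hQ'
  set V : Obs d Λ := (hQ.eigenvectorUnitary : Obs d Λ) with hV
  have hVV : Vᴴ * V = 1 := Unitary.coe_star_mul_self hQ.eigenvectorUnitary
  have hdiag : Vᴴ * (Qᴴ * Q) * V = Matrix.diagonal (fun i => (hQ.eigenvalues i : ℂ)) := by
    have h := hQ.spectral_theorem
    rw [Unitary.conjStarAlgAut_apply] at h
    have h' : Qᴴ * Q = V * Matrix.diagonal (fun i => (hQ.eigenvalues i : ℂ)) * Vᴴ := h
    calc Vᴴ * (Qᴴ * Q) * V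
        = Vᴴ * (V * Matrix.diagonal (fun i => (hQ.eigenvalues i : ℂ)) * Vᴴ) * V :=
          congrArg (fun Z => Vᴴ * Z * V) h'
      _ = (Vᴴ * V) * Matrix.diagonal (fun i => (hQ.eigenvalues i : ℂ)) * (Vᴴ * V) := by
          simp only [mul_assoc]
      _ = _ := by rw [hVV, one_mul, mul_one]
  have hpos : ∀ i, 0 ≤ hQ.eigenvalues i :=
    fun i => (Matrix.posSemidef_conjTranspose_mul_self Q).eigenvalues_nonneg i
  set s : Config d Λ → ℝ := fun i => Real.sqrt (hQ.eigenvalues i) with hs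
  have hss : ∀ i, hQ.eigenvalues i = s i * s i := fun i => (Real.mul_self_sqrt (hpos i)).symm
  -- With 0⁻¹ = 0 this is the pseudo-inverse of the singular values, so W is a partial isometry even
  -- when Q is singular.
  set T : Obs d Λ := Matrix.diagonal (fun i => (((s i)⁻¹ : ℝ) : ℂ)) with hT
  have hTT : Tᴴ = T := by
    rw [hT, Matrix.diagonal_conjTranspose]
    congr 1
    funext i
    simp
  have hWd : (Q * V * T)ᴴ * (Q * V * T)
      = Matrix.diagonal (fun i => (((s i)⁻¹ * (s i * s i) * (s i)⁻¹ : ℝ) : ℂ)) := by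
    calc (Q * V * T)ᴴ * (Q * V * T) = Tᴴ * (Vᴴ * (Qᴴ * Q) * V) * T := by
          simp only [Matrix.conjTranspose_mul, mul_assoc]
      _ = _ := by
          rw [hdiag, hTT, hT, Matrix.diagonal_mul_diagonal, Matrix.diagonal_mul_diagonal]
          congr 1
          funext i
          rw [hss i]
          push_cast
          ring
  refine ⟨Q * V * T, V, ?_, ?_, ?_⟩
  · have h1 : ‖(Q * V * T)ᴴ * (Q * V * T)‖ ≤ 1 := by
      rw [hWd, Matrix.l2_opNorm_diagonal]
      refine (pi_norm_le_iff_of_nonneg zero_le_one).2 fun i => ?_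
      rw [Complex.norm_real, Real.norm_eq_abs]
      rcases eq_or_ne (s i) 0 with h0 | h0
      · simp [h0]
      · rw [show (s i)⁻¹ * (s i * s i) * (s i)⁻¹ = 1 by field_simp]
        simp
    rw [Matrix.l2_opNorm_conjTranspose_mul_self] at h1
    nlinarith [norm_nonneg (Q * V * T)]
  · have h1 : ‖Vᴴ * V‖ ≤ 1 := by
      rw [hVV, ← Matrix.diagonal_one, Matrix.l2_opNorm_diagonal]
      exact (pi_norm_le_iff_of_nonneg zero_le_one).2 fun i => by simp
    rw [Matrix.l2_opNorm_conjTranspose_mul_self] at h1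
    nlinarith [norm_nonneg V]
  · have h1 : (Q * V * T)ᴴ * Q * V
        = Matrix.diagonal (fun i => (((s i)⁻¹ * (s i * s i) : ℝ) : ℂ)) := by
      calc (Q * V * T)ᴴ * Q * V = Tᴴ * (Vᴴ * (Qᴴ * Q) * V) := by
            simp only [Matrix.conjTranspose_mul, mul_assoc]
        _ = _ := by
            rw [hdiag, hTT, hT, Matrix.diagonal_mul_diagonal]
            congr 1
            funext i
            rw [hss i]
            push_cast
            ring
    rw [h1, Matrix.trace_diagonal, Complex.re_sum]
    refine Finset.sum_congr rfl fun i _ => ?_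
    rw [Complex.ofReal_re]
    change s i = _
    rcases eq_or_ne (s i) 0 with h0 | h0
    · simp [h0]
    · field_simp

/-- Hölder's inequality, in the form in which a Schatten 1-norm is bounded by an operator norm and
two Hilbert-Schmidt norms. -/
theorem traceNorm_mul_mul_le {d : ℕ} {Λ : Finset ℤ} (X D Y : Obs d Λ) {t : ℝ} (ht : 0 < t)
    (hD : ‖D‖ ≤ t) : traceNorm (X * D * Y) ≤ t * (hsSq X + hsSq Y) / 2 := by
  obtain ⟨W, V, hW, hV, e⟩ := exists_traceNorm_eq (X * D * Y)
  have e' : Wᴴ * (X * D * Y) * V = (Xᴴ * W)ᴴ * (D * (Y * V)) := by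
    rw [Matrix.conjTranspose_mul, Matrix.conjTranspose_conjTranspose]
    simp only [mul_assoc]
  -- With the bound on D as weight, both terms on the right carry the same factor t².
  have h1 := two_mul_re_trace_le (Xᴴ * W) (D * (Y * V)) t
  rw [← e', ← e] at h1
  have h2 : hsSq (Xᴴ * W) ≤ hsSq X := by
    refine (hsSq_mul_le' _ _).trans ?_
    rw [hsSq_conjTranspose]
    exact mul_le_of_le_one_left (hsSq_nonneg X) (pow_le_one₀ (norm_nonneg _) hW)
  have h3 : hsSq (D * (Y * V)) ≤ t ^ 2 * hsSq Y := by
    have h5 : hsSq (Y * V) ≤ hsSq Y := (hsSq_mul_le' _ _).trans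
      (mul_le_of_le_one_left (hsSq_nonneg Y) (pow_le_one₀ (norm_nonneg _) hV))
    exact (hsSq_mul_le _ _).trans (mul_le_mul (pow_le_pow_left₀ (norm_nonneg _) hD 2) h5
      (hsSq_nonneg _) (sq_nonneg t))
  have h4 : 2 * t * traceNorm (X * D * Y) ≤ 2 * t * (t * (hsSq X + hsSq Y) / 2) := by
    have := mul_le_mul_of_nonneg_left h2 (sq_nonneg t)
    linarith
  exact le_of_mul_le_mul_left h4 (by positivity)

end TraceNorm

/-! ### The exact formula for the Markov defect. -/

section Factorization

variable {𝔸 : Type*} [CStarAlgebra 𝔸] {ι κ : Type*} [Fintype ι] [Fintype κ]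

/-- The Kraus operators of the partial trace with matrix units `e` against the Gibbs weight
`e^{-2k} / z`. -/
def gibbsKraus (e : ι → 𝔸) (k : 𝔸) (z : ℝ) (i : ι) : 𝔸 :=
  (Real.sqrt z)⁻¹ • (e i * NormedSpace.exp (-k))

theorem star_exp_of_isSelfAdjoint {k : 𝔸} (hk : IsSelfAdjoint k) :
    star (NormedSpace.exp k) = NormedSpace.exp k := by
  rw [NormedSpace.star_exp, hk.star_eq]

theorem kraus_gibbsKraus {e : ι → 𝔸} {k : 𝔸} (hk : IsSelfAdjoint k) {z : ℝ} (hz : 0 < z)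
    (Q : 𝔸) : kraus (gibbsKraus e k z) Q
      = z⁻¹ • kraus e (NormedSpace.exp (-k) * Q * NormedSpace.exp (-k)) := by
  simp only [kraus, gibbsKraus, Finset.smul_sum]
  refine Finset.sum_congr rfl fun i _ => ?_
  rw [star_smul, star_mul, star_exp_of_isSelfAdjoint hk.neg, star_trivial, smul_mul_assoc,
    smul_mul_assoc, mul_smul_comm, smul_smul, ← mul_inv, Real.mul_self_sqrt hz.le]
  simp only [mul_assoc]

theorem kraus_gibbsKraus_one {e : ι → 𝔸} {k : 𝔸} (hk : IsSelfAdjoint k) {z : ℝ} (hz : 0 < z)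
    (h : kraus e (NormedSpace.exp (-k) * NormedSpace.exp (-k)) = z • (1 : 𝔸)) :
    kraus (gibbsKraus e k z) 1 = 1 := by
  rw [kraus_gibbsKraus hk hz, mul_one, h, inv_smul_smul₀ hz.ne']

/-- The weight e^{-k} inside the map cancels e^k, and e^x, living off the traced region, moves out
of the partial trace. -/
theorem kraus_gibbsKraus_conj {e : ι → 𝔸} {k x : 𝔸} (hk : IsSelfAdjoint k) {z : ℝ} (hz : 0 < z)
    (hxk : Commute x k) (hx : ∀ i, Commute x (e i)) (hx' : ∀ i, Commute x (star (e i))) (Q : 𝔸) :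
    kraus (gibbsKraus e k z) (NormedSpace.exp (x + k) * Q * NormedSpace.exp (x + k))
      = z⁻¹ • (NormedSpace.exp x * kraus e Q * NormedSpace.exp x) := by
  have h1 : NormedSpace.exp (-k) * NormedSpace.exp (x + k) = NormedSpace.exp x := by
    rw [add_comm, exp_add_commute hxk.symm, ← mul_assoc, exp_neg_mul_exp, one_mul]
  have h2 : NormedSpace.exp (x + k) * NormedSpace.exp (-k) = NormedSpace.exp x := by
    rw [exp_add_commute hxk, mul_assoc, exp_mul_exp_neg, mul_one]
  rw [kraus_gibbsKraus hk hz]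
  congr 1
  calc _ = kraus e ((NormedSpace.exp (-k) * NormedSpace.exp (x + k)) * Q *
        (NormedSpace.exp (x + k) * NormedSpace.exp (-k))) := by simp only [mul_assoc]
    _ = kraus e (NormedSpace.exp x * Q * NormedSpace.exp x) := by rw [h1, h2]
    _ = _ := by
      rw [kraus_mul_right fun i => (hx' i).symm.exp_right.symm,
        kraus_mul_left fun i => (hx i).symm.exp_right.symm]

theorem commute_of_inverse {x M R : 𝔸} (h : Commute x M) (h1 : R * M = 1) (h2 : M * R = 1) :
    Commute x R := by
  calc x * R = R * M * x * R := by rw [h1, one_mul]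
    _ = R * (x * M) * R := by rw [h.eq]; simp only [mul_assoc]
    _ = R * x := by rw [mul_assoc, mul_assoc, h2, mul_one]

/-- The local data that enter the approximate Markov property: the half Hamiltonians of the
regions, and the matrix units of the outer regions. -/
structure MarkovData (hA hB hC hAB hBC : 𝔸) (eA : ι → 𝔸) (eC : κ → 𝔸) (zA zC : ℝ) : Prop where
  saA : IsSelfAdjoint hA
  saB : IsSelfAdjoint hB
  saC : IsSelfAdjoint hC
  saAB : IsSelfAdjoint hAB
  saBC : IsSelfAdjoint hBC
  zA_pos : 0 < zA
  zC_pos : 0 < zC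
  normA : kraus eA (NormedSpace.exp (-hA) * NormedSpace.exp (-hA)) = zA • (1 : 𝔸)
  normC : kraus eC (NormedSpace.exp (-hC) * NormedSpace.exp (-hC)) = zC • (1 : 𝔸)
  cAB : Commute hA hB
  cAC : Commute hA hC
  cBC : Commute hB hC
  cA_BC : Commute hA hBC
  cAB_C : Commute hAB hC
  eA_B : ∀ i, Commute hB (eA i)
  eA_C : ∀ i, Commute hC (eA i)
  eA_BC : ∀ i, Commute hBC (eA i)
  eC_A : ∀ i, Commute hA (eC i)
  eC_B : ∀ i, Commute hB (eC i)
  eC_AB : ∀ i, Commute hAB (eC i)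
  krausA : ∀ Q, Commute hA (kraus eA Q)
  krausC : ∀ Q, Commute hC (kraus eC Q)

theorem commute_star_of_isSelfAdjoint {x y : 𝔸} (hx : IsSelfAdjoint x) (h : Commute x y) :
    Commute x (star y) := by
  simpa [hx.star_eq] using h.star_star

variable {hA hB hC hAB hBC : 𝔸} {eA : ι → 𝔸} {eC : κ → 𝔸} {zA zC : ℝ}

theorem MarkovData.kraus_C (D : MarkovData hA hB hC hAB hBC eA eC zA zC) {h : 𝔸}
    (hh : IsSelfAdjoint h) {F : 𝔸} (hF : F = NormedSpace.exp (-h) * NormedSpace.exp (hAB + hC)) :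
    kraus (gibbsKraus eC hC zC) (star F * F) = zC⁻¹ • (NormedSpace.exp hAB *
      kraus eC (NormedSpace.exp (-h) * NormedSpace.exp (-h)) * NormedSpace.exp hAB) := by
  rw [← kraus_gibbsKraus_conj D.saC D.zC_pos D.cAB_C D.eC_AB
    (fun i => commute_star_of_isSelfAdjoint D.saAB (D.eC_AB i)), hF, star_mul,
    star_exp_of_isSelfAdjoint hh.neg, star_exp_of_isSelfAdjoint (D.saAB.add D.saC)]
  simp only [mul_assoc]

theorem MarkovData.kraus_A (D : MarkovData hA hB hC hAB hBC eA eC zA zC) {h : 𝔸}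
    (hh : IsSelfAdjoint h) {F : 𝔸} (hF : F = NormedSpace.exp (-h) * NormedSpace.exp (hA + hBC)) :
    kraus (gibbsKraus eA hA zA) (star F * F) = zA⁻¹ • (NormedSpace.exp hBC *
      kraus eA (NormedSpace.exp (-h) * NormedSpace.exp (-h)) * NormedSpace.exp hBC) := by
  rw [← kraus_gibbsKraus_conj D.saA D.zA_pos D.cA_BC.symm D.eA_BC
    (fun i => commute_star_of_isSelfAdjoint D.saBC (D.eA_BC i)), hF, star_mul,
    star_exp_of_isSelfAdjoint hh.neg, star_exp_of_isSelfAdjoint (D.saA.add D.saBC), add_comm hBC]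
  simp only [mul_assoc]

/-- In F E' the factors e^{±h_BC} cancel, leaving e^{-h} e^{h_A + h_B + h_C}. Thus M is the marginal
on B conjugated by e^{h_B}, and inverting M inverts the marginal. -/
theorem MarkovData.kraus_AC (D : MarkovData hA hB hC hAB hBC eA eC zA zC) {h : 𝔸}
    (hh : IsSelfAdjoint h) {F E' : 𝔸}
    (hF : F = NormedSpace.exp (-h) * NormedSpace.exp (hA + hBC))
    (hE' : E' = NormedSpace.exp (-hBC) * NormedSpace.exp (hB + hC)) :
    kraus (gibbsKraus eA hA zA) (kraus (gibbsKraus eC hC zC) (star (F * E') * (F * E')))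
      = (zA⁻¹ * zC⁻¹) • (NormedSpace.exp hB *
        kraus eA (kraus eC (NormedSpace.exp (-h) * NormedSpace.exp (-h))) *
          NormedSpace.exp hB) := by
  have hT : F * E' = NormedSpace.exp (-h) * NormedSpace.exp (hB + hA + hC) := by
    rw [hF, hE', exp_add_commute D.cA_BC, add_comm hB hA, add_assoc,
      exp_add_commute (D.cAB.add_right D.cAC)]
    calc _ = NormedSpace.exp (-h) * NormedSpace.exp hA *
          (NormedSpace.exp hBC * NormedSpace.exp (-hBC)) * NormedSpace.exp (hB + hC) := by
          simp only [mul_assoc]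
      _ = _ := by rw [exp_mul_exp_neg, mul_one, mul_assoc]
  have h1 : star (F * E') * (F * E') = NormedSpace.exp (hB + hA + hC) *
      (NormedSpace.exp (-h) * NormedSpace.exp (-h)) * NormedSpace.exp (hB + hA + hC) := by
    rw [hT, star_mul, star_exp_of_isSelfAdjoint hh.neg,
      star_exp_of_isSelfAdjoint ((D.saB.add D.saA).add D.saC)]
    simp only [mul_assoc]
  rw [h1, kraus_gibbsKraus_conj D.saC D.zC_pos (D.cBC.add_left D.cAC)
    (fun i => (D.eC_B i).add_left (D.eC_A i)) (fun i => commute_star_of_isSelfAdjoint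
      (D.saB.add D.saA) ((D.eC_B i).add_left (D.eC_A i)))]
  have hsmul : ∀ (c : ℝ) (Q : 𝔸), kraus (gibbsKraus eA hA zA) (c • Q)
      = c • kraus (gibbsKraus eA hA zA) Q := by
    intro c Q
    simp only [kraus, mul_smul_comm, smul_mul_assoc, ← Finset.smul_sum]
  rw [hsmul, kraus_gibbsKraus_conj D.saA D.zA_pos D.cAB.symm D.eA_B
    (fun i => commute_star_of_isSelfAdjoint D.saB (D.eA_B i)), smul_smul, mul_comm zC⁻¹]

theorem conj_exp_cancel (x Q : 𝔸) : NormedSpace.exp (-x) *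
    (NormedSpace.exp x * Q * NormedSpace.exp x) * NormedSpace.exp (-x) = Q := by
  calc _ = (NormedSpace.exp (-x) * NormedSpace.exp x) * Q *
        (NormedSpace.exp x * NormedSpace.exp (-x)) := by simp only [mul_assoc]
    _ = Q := by rw [exp_neg_mul_exp, exp_mul_exp_neg, one_mul, mul_one]

/-- S, S' and R are, up to scalars, the marginals on AB and BC and the inverse marginal on B,
dressed with exponentials. The expansionals E and E'* convert one dressing into the next, and the
scalars zA, zC cancel. -/
theorem MarkovData.defect_eq (D : MarkovData hA hB hC hAB hBC eA eC zA zC) {h : 𝔸}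
    (hh : IsSelfAdjoint h) {FA FC E E' R : 𝔸}
    (hFA : FA = NormedSpace.exp (-h) * NormedSpace.exp (hA + hBC))
    (hFC : FC = NormedSpace.exp (-h) * NormedSpace.exp (hAB + hC))
    (hE : E = NormedSpace.exp (-hAB) * NormedSpace.exp (hA + hB))
    (hE' : E' = NormedSpace.exp (-hBC) * NormedSpace.exp (hB + hC))
    (hR1 : R * kraus (gibbsKraus eA hA zA)
      (kraus (gibbsKraus eC hC zC) (star (FA * E') * (FA * E'))) = 1)
    (hR2 : kraus (gibbsKraus eA hA zA)
      (kraus (gibbsKraus eC hC zC) (star (FA * E') * (FA * E'))) * R = 1) :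
    ∃ N, kraus eA (kraus eC (NormedSpace.exp (-h) * NormedSpace.exp (-h))) * N = 1 ∧
      N * kraus eA (kraus eC (NormedSpace.exp (-h) * NormedSpace.exp (-h))) = 1 ∧
      NormedSpace.exp (-h) * NormedSpace.exp (-h) -
        kraus eC (NormedSpace.exp (-h) * NormedSpace.exp (-h)) * N *
          kraus eA (NormedSpace.exp (-h) * NormedSpace.exp (-h)) =
      NormedSpace.exp (-(hAB + hC)) * (star FC * FA -
        kraus (gibbsKraus eC hC zC) (star FC * FC) * E * R * star E' *
          kraus (gibbsKraus eA hA zA) (star FA * FA)) * NormedSpace.exp (-(hA + hBC)) := by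
  have hS := D.kraus_C hh hFC
  have hS' := D.kraus_A hh hFA
  have hM := D.kraus_AC hh hFA hE'
  set G := NormedSpace.exp (-h) * NormedSpace.exp (-h) with hG
  set S := kraus (gibbsKraus eC hC zC) (star FC * FC)
  set S' := kraus (gibbsKraus eA hA zA) (star FA * FA)
  set M := kraus (gibbsKraus eA hA zA) (kraus (gibbsKraus eC hC zC) (star (FA * E') * (FA * E')))
  set K := kraus eA (kraus eC G)
  have zA0 := D.zA_pos.ne'
  have zC0 := D.zC_pos.ne'
  have hKC : kraus eC G = zC • (NormedSpace.exp (-hAB) * S * NormedSpace.exp (-hAB)) := by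
    rw [hS, mul_smul_comm, smul_mul_assoc, conj_exp_cancel, smul_inv_smul₀ zC0]
  have hKA : kraus eA G = zA • (NormedSpace.exp (-hBC) * S' * NormedSpace.exp (-hBC)) := by
    rw [hS', mul_smul_comm, smul_mul_assoc, conj_exp_cancel, smul_inv_smul₀ zA0]
  have hK : K = (zA * zC) • (NormedSpace.exp (-hB) * M * NormedSpace.exp (-hB)) := by
    rw [hM, mul_smul_comm, smul_mul_assoc, conj_exp_cancel, ← mul_inv,
      smul_inv_smul₀ (mul_ne_zero zA0 zC0)]
  -- commutation with the boundary weights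
  have cAK : Commute hA K := D.krausA _
  have cCK : Commute hC K := commute_kraus D.eA_C
    (fun i => commute_star_of_isSelfAdjoint D.saC (D.eA_C i)) (D.krausC _)
  have cAM : Commute hA M := by
    rw [hM]
    exact ((D.cAB.exp_right.mul_right cAK).mul_right D.cAB.exp_right).smul_right _
  have cCM : Commute hC M := by
    rw [hM]
    exact ((D.cBC.symm.exp_right.mul_right cCK).mul_right D.cBC.symm.exp_right).smul_right _
  have cAR : Commute R (NormedSpace.exp (-hA)) :=
    (commute_of_inverse cAM hR1 hR2).symm.neg_right.exp_right
  have cCR : Commute R (NormedSpace.exp (-hC)) :=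
    (commute_of_inverse cCM hR1 hR2).symm.neg_right.exp_right
  have cCS : Commute S (NormedSpace.exp (-hC)) := by
    have : Commute hC S := by
      rw [hS]
      exact ((D.cAB_C.symm.exp_right.mul_right (D.krausC _)).mul_right
        D.cAB_C.symm.exp_right).smul_right _
    exact this.symm.neg_right.exp_right
  have cAS' : Commute S' (NormedSpace.exp (-hA)) := by
    have : Commute hA S' := by
      rw [hS']
      exact ((D.cA_BC.exp_right.mul_right (D.krausA _)).mul_right
        D.cA_BC.exp_right).smul_right _
    exact this.symm.neg_right.exp_right
  have cCE : Commute E (NormedSpace.exp (-hC)) := by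
    have : Commute hC E := by
      rw [hE]
      exact (D.cAB_C.symm.neg_right.exp_right).mul_right
        ((D.cAC.symm.add_right D.cBC.symm).exp_right)
    exact this.symm.neg_right.exp_right
  have hsE' : star E' = NormedSpace.exp (hB + hC) * NormedSpace.exp (-hBC) := by
    rw [hE', star_mul, star_exp_of_isSelfAdjoint D.saBC.neg,
      star_exp_of_isSelfAdjoint (D.saB.add D.saC)]
  have cAE' : Commute (star E') (NormedSpace.exp (-hA)) := by
    have : Commute hA (star E') := by
      rw [hsE']
      exact ((D.cAB.add_right D.cAC).exp_right).mul_right D.cA_BC.neg_right.exp_right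
    exact this.symm.neg_right.exp_right
  -- Here E and E' play their part: they exchange the outer weights e^{-h_A}, e^{-h_C} for the
  -- e^{h_B} that surround R.
  have hEa : E * NormedSpace.exp (-hA) = NormedSpace.exp (-hAB) * NormedSpace.exp hB := by
    rw [hE, add_comm hA hB, exp_add_commute D.cAB.symm, mul_assoc, mul_assoc, exp_mul_exp_neg,
      mul_one]
  have hEc : NormedSpace.exp (-hC) * star E' = NormedSpace.exp hB * NormedSpace.exp (-hBC) := by
    rw [hsE', add_comm hB hC, exp_add_commute D.cBC.symm, ← mul_assoc, ← mul_assoc,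
      exp_neg_mul_exp, one_mul]
  have hX : NormedSpace.exp (-(hAB + hC)) = NormedSpace.exp (-hAB) * NormedSpace.exp (-hC) := by
    rw [neg_add, exp_add_commute D.cAB_C.neg_left.neg_right]
  have hY : NormedSpace.exp (-(hA + hBC)) = NormedSpace.exp (-hA) * NormedSpace.exp (-hBC) := by
    rw [neg_add, exp_add_commute D.cA_BC.neg_left.neg_right]
  refine ⟨(zA * zC)⁻¹ • (NormedSpace.exp hB * R * NormedSpace.exp hB), ?_, ?_, ?_⟩
  · rw [hK, smul_mul_smul_comm, mul_inv_cancel₀ (mul_ne_zero zA0 zC0), one_smul]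
    calc _ = NormedSpace.exp (-hB) * M * (NormedSpace.exp (-hB) * NormedSpace.exp hB) * R *
          NormedSpace.exp hB := by simp only [mul_assoc]
      _ = NormedSpace.exp (-hB) * (M * R) * NormedSpace.exp hB := by
        rw [exp_neg_mul_exp, mul_one]; simp only [mul_assoc]
      _ = 1 := by rw [hR2, mul_one, exp_neg_mul_exp]
  · rw [hK, smul_mul_smul_comm, inv_mul_cancel₀ (mul_ne_zero zA0 zC0), one_smul]
    calc _ = NormedSpace.exp hB * R * (NormedSpace.exp hB * NormedSpace.exp (-hB)) * M *
          NormedSpace.exp (-hB) := by simp only [mul_assoc]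
      _ = NormedSpace.exp hB * (R * M) * NormedSpace.exp (-hB) := by
        rw [exp_mul_exp_neg, mul_one]; simp only [mul_assoc]
      _ = 1 := by rw [hR1, mul_one, exp_mul_exp_neg]
  · rw [mul_sub, sub_mul]
    congr 1
    · rw [hFC, hFA, star_mul, star_exp_of_isSelfAdjoint hh.neg,
        star_exp_of_isSelfAdjoint (D.saAB.add D.saC)]
      calc G = (NormedSpace.exp (-(hAB + hC)) * NormedSpace.exp (hAB + hC)) *
            (NormedSpace.exp (-h) * NormedSpace.exp (-h)) *
            (NormedSpace.exp (hA + hBC) * NormedSpace.exp (-(hA + hBC))) := by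
            rw [exp_neg_mul_exp, exp_mul_exp_neg, one_mul, mul_one]
        _ = _ := by simp only [mul_assoc]
    · rw [hKC, hKA, smul_mul_smul_comm, smul_mul_smul_comm,
        show zC * (zA * zC)⁻¹ * zA = 1 by field_simp, one_smul, hX, hY]
      set c := NormedSpace.exp (-hC)
      set a := NormedSpace.exp (-hA)
      set p := NormedSpace.exp (-hAB)
      set q := NormedSpace.exp (-hBC)
      set β := NormedSpace.exp hB
      symm
      calc p * c * (S * E * R * star E' * S') * (a * q)
          = p * (c * (S * E * R)) * (star E' * S' * a) * q := by simp only [mul_assoc]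
        _ = p * (S * E * R * c) * (a * (star E' * S')) * q := by
          rw [((cCS.mul_left cCE).mul_left cCR).eq, (cAE'.mul_left cAS').eq]
        _ = p * S * E * (R * (c * a)) * star E' * S' * q := by simp only [mul_assoc]
        _ = p * S * E * (R * (a * c)) * star E' * S' * q := by
          rw [((D.cAC.neg_left.neg_right.exp_right).symm.exp_right).eq]
        _ = p * S * E * (R * a) * c * star E' * S' * q := by simp only [mul_assoc]
        _ = p * S * (E * a) * R * (c * star E') * S' * q := by
          rw [cAR.eq]; simp only [mul_assoc]
        _ = p * S * p * (β * R * β) * (q * S' * q) := by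
          rw [hEa, hEc]; simp only [mul_assoc]

end Factorization

/-! ### The spin chain as an instance of the abstract setting. -/

section GibbsLocality

open scoped Matrix.Norms.L2Operator MatrixOrder ComplexOrder

variable {d : ℕ} {I : Finset ℤ}

/-- The half interaction `Φ_X / 2`, embedded in `𝔄_I`. -/
def Interaction.half (Φ : Interaction d) (I X : Finset ℤ) : Obs d I :=
  if h : X ⊆ I then (2⁻¹ : ℝ) • embed h (Φ.toFun X) else 0

theorem isSelfAdjoint_embed {Λ : Finset ℤ} (h : Λ ⊆ I) {Q : Obs d Λ} (hQ : Q.IsHermitian) :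
    IsSelfAdjoint (embed h Q) := by
  rw [IsSelfAdjoint, ← embedHom_apply, ← map_star]
  exact congrArg _ hQ

theorem Interaction.isLocalFamily_half (Φ : Interaction d) {r : ℕ} {J : ℝ} (hJ : 0 < J)
    (hr : Φ.HasRange r) (hs : Φ.HasStrength J) (I : Finset ℤ) :
    IsLocalFamily (Φ.half I) r J where
  range X hX := by
    unfold Interaction.half
    split
    · rw [hr X hX, ← embedHom_apply, map_zero, smul_zero]
    · rfl
  strength X := by
    unfold Interaction.half
    split
    · rename_i h
      have h1 : ‖embed h (Φ.toFun X)‖ ≤ J := (norm_embed_le h _).trans (hs X)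
      rw [norm_smul]
      norm_num
      linarith [norm_nonneg (embed h (Φ.toFun X))]
    · rw [norm_zero]; exact hJ.le
  commute X Y hd := by
    unfold Interaction.half
    split
    · split
      · exact ((commute_embed _ _ hd _ _).smul_left _).smul_right _
      · exact Commute.zero_right _
    · exact Commute.zero_left _

theorem Interaction.localSum_half (Φ : Interaction d) {Λ : Finset ℤ} (h : Λ ⊆ I) :
    localSum (Φ.half I) Λ = embed h ((2⁻¹ : ℝ) • Φ.hamiltonian Λ) := by
  have e : embed h ((2⁻¹ : ℝ) • Φ.hamiltonian Λ)
      = (2⁻¹ : ℝ) • ∑ X ∈ Λ.powerset.attach,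
        embed ((Finset.mem_powerset.1 X.2).trans h) (Φ.toFun X.1) := by
    rw [← embedHom_apply, ← Complex.coe_smul, map_smul, Complex.coe_smul, Interaction.hamiltonian,
      map_sum]
    simp only [embedHom_apply, embed_embed]
  rw [e, Finset.smul_sum, localSum, ← Finset.sum_attach]
  refine Finset.sum_congr rfl fun X _ => ?_
  rw [Interaction.half, dif_pos]

theorem Interaction.isHermitian_hamiltonian (Φ : Interaction d) (Λ : Finset ℤ) :
    (Φ.hamiltonian Λ).IsHermitian := by
  have : IsSelfAdjoint (Φ.hamiltonian Λ) :=
    isSelfAdjoint_sum _ fun X _ => isSelfAdjoint_embed _ (Φ.isHermitian X.1)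
  exact this

theorem Interaction.isHermitian_half_hamiltonian (Φ : Interaction d) (Λ : Finset ℤ) :
    ((2⁻¹ : ℝ) • Φ.hamiltonian Λ).IsHermitian := by
  have : IsSelfAdjoint (Φ.hamiltonian Λ) := Φ.isHermitian_hamiltonian Λ
  exact (IsSelfAdjoint.all (2⁻¹ : ℝ)).smul this

theorem Interaction.isSelfAdjoint_localSum (Φ : Interaction d) {Λ : Finset ℤ} (h : Λ ⊆ I) :
    IsSelfAdjoint (localSum (Φ.half I) Λ) := by
  rw [Φ.localSum_half h]
  exact isSelfAdjoint_embed h (Φ.isHermitian_half_hamiltonian Λ)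

theorem exp_neg_two_halves (H : Obs d I) :
    NormedSpace.exp (-H) = NormedSpace.exp (-((2⁻¹ : ℝ) • H)) *
      NormedSpace.exp (-((2⁻¹ : ℝ) • H)) := by
  rw [← exp_add_commute (Commute.refl _), ← neg_add, ← add_smul]
  norm_num

theorem embed_self (Q : Obs d I) : embed (Finset.Subset.refl I) Q = Q := by
  ext σ τ
  rw [embed_apply, if_pos fun x hx => (hx x.2).elim]
  rfl

theorem Interaction.exp_hamiltonian_eq (Φ : Interaction d) (I : Finset ℤ) :
    NormedSpace.exp (-Φ.hamiltonian I) = NormedSpace.exp (-localSum (Φ.half I) I) *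
      NormedSpace.exp (-localSum (Φ.half I) I) := by
  rw [Φ.localSum_half (Finset.Subset.refl I), embed_self, exp_neg_two_halves]

theorem hsSq_exp_pos [NeZero d] (H : Obs d I) : 0 < hsSq (NormedSpace.exp H) := by
  refine lt_of_le_of_ne (hsSq_nonneg _) fun h0 => ?_
  have h1 := (Matrix.posSemidef_conjTranspose_mul_self (NormedSpace.exp H)).trace_nonneg
  have h2 : ((NormedSpace.exp H)ᴴ * NormedSpace.exp H).trace = 0 :=
    Complex.ext h0.symm (Complex.le_def.1 h1).2.symm
  have h3 := Matrix.trace_conjTranspose_mul_self_eq_zero_iff.1 h2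
  have h4 := exp_mul_exp_neg H
  rw [h3, zero_mul] at h4
  exact zero_ne_one h4

theorem trace_exp_eq {H : Obs d I} (hH : H.IsHermitian) :
    (NormedSpace.exp (-H) * NormedSpace.exp (-H)).trace
      = ((hsSq (NormedSpace.exp (-H)) : ℝ) : ℂ) := by
  have hs : (NormedSpace.exp (-H))ᴴ = NormedSpace.exp (-H) :=
    star_exp_of_isSelfAdjoint (k := -H) (IsSelfAdjoint.neg hH)
  have h1 := (Matrix.posSemidef_conjTranspose_mul_self (NormedSpace.exp (-H))).trace_nonneg
  rw [hsSq]
  rw [hs] at h1 ⊢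
  exact Complex.ext (by simp) (Complex.le_def.1 h1).2.symm

theorem Interaction.kraus_exp_localSum (Φ : Interaction d) {C : Finset ℤ} (hC : C ⊆ I) :
    kraus (matUnit hC) (NormedSpace.exp (-localSum (Φ.half I) C) *
      NormedSpace.exp (-localSum (Φ.half I) C))
      = hsSq (NormedSpace.exp (-((2⁻¹ : ℝ) • Φ.hamiltonian C))) • (1 : Obs d I) := by
  rw [Φ.localSum_half hC, ← embedHom_apply, ← map_neg, embedHom_apply, ← embed_exp,
    ← embedHom_apply, ← map_mul, embedHom_apply, kraus_matUnit_embed,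
    trace_exp_eq (Φ.isHermitian_half_hamiltonian C), Complex.coe_smul]

theorem Interaction.commute_matUnit (Φ : Interaction d) {Λ C : Finset ℤ} (hΛ : Λ ⊆ I)
    (hC : C ⊆ I) (hd : Disjoint Λ C) (p : Config d C × Config d C) :
    Commute (localSum (Φ.half I) Λ) (matUnit hC p) := by
  rw [Φ.localSum_half hΛ]
  exact commute_embed _ _ hd _ _

/-- After tracing out C the result is supported on the complement of C. -/
theorem Interaction.commute_kraus_matUnit (Φ : Interaction d) {C : Finset ℤ} (hC : C ⊆ I)
    (Q : Obs d I) : Commute (localSum (Φ.half I) C) (kraus (matUnit hC) Q) := by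
  rw [← reduced_eq_kraus (Finset.sdiff_subset (s := I) (t := C)) hC (Finset.sdiff_sdiff_eq_self hC),
    Φ.localSum_half hC]
  exact commute_embed _ _ Finset.disjoint_sdiff _ _

theorem Interaction.markovData [NeZero d] (Φ : Interaction d) {r : ℕ} {J : ℝ}
    (hloc : IsLocalFamily (Φ.half I) r J) {a m n b : ℤ} (ham : a ≤ m) (hmn : m ≤ n)
    (hA : Finset.Ico a m ⊆ I) (hC : Finset.Ico n b ⊆ I) (hAB : Finset.Ico a n ⊆ I)
    (hBC : Finset.Ico m b ⊆ I) :
    MarkovData (localSum (Φ.half I) (Finset.Ico a m)) (localSum (Φ.half I) (Finset.Ico m n))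
      (localSum (Φ.half I) (Finset.Ico n b)) (localSum (Φ.half I) (Finset.Ico a n))
      (localSum (Φ.half I) (Finset.Ico m b)) (matUnit hA) (matUnit hC)
      (hsSq (NormedSpace.exp (-((2⁻¹ : ℝ) • Φ.hamiltonian (Finset.Ico a m)))))
      (hsSq (NormedSpace.exp (-((2⁻¹ : ℝ) • Φ.hamiltonian (Finset.Ico n b))))) := by
  have hB : Finset.Ico m n ⊆ I := (Finset.Ico_subset_Ico_left ham).trans hAB
  have dis : ∀ {x y z w : ℤ}, y ≤ z → Disjoint (Finset.Ico x y) (Finset.Ico z w) := by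
    intro x y z w hyz
    refine Finset.disjoint_left.2 fun t h1 h2 => ?_
    rw [Finset.mem_Ico] at h1 h2
    omega
  exact
  { saA := Φ.isSelfAdjoint_localSum hA
    saB := Φ.isSelfAdjoint_localSum hB
    saC := Φ.isSelfAdjoint_localSum hC
    saAB := Φ.isSelfAdjoint_localSum hAB
    saBC := Φ.isSelfAdjoint_localSum hBC
    zA_pos := hsSq_exp_pos _
    zC_pos := hsSq_exp_pos _
    normA := Φ.kraus_exp_localSum hA
    normC := Φ.kraus_exp_localSum hC
    cAB := hloc.commute_localSum (dis le_rfl)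
    cAC := hloc.commute_localSum (dis hmn)
    cBC := hloc.commute_localSum (dis le_rfl)
    cA_BC := hloc.commute_localSum (dis le_rfl)
    cAB_C := hloc.commute_localSum (dis le_rfl)
    eA_B := Φ.commute_matUnit hB hA (dis le_rfl).symm
    eA_C := Φ.commute_matUnit hC hA (dis hmn).symm
    eA_BC := Φ.commute_matUnit hBC hA (dis le_rfl).symm
    eC_A := Φ.commute_matUnit hA hC (dis hmn)
    eC_B := Φ.commute_matUnit hB hC (dis le_rfl)
    eC_AB := Φ.commute_matUnit hAB hC (dis le_rfl)
    krausA := Φ.commute_kraus_matUnit hA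
    krausC := Φ.commute_kraus_matUnit hC }

end GibbsLocality

/-! ### Assembling the trace norm estimate. -/

section Estimate

open scoped Matrix.Norms.L2Operator MatrixOrder ComplexOrder

variable {d : ℕ} {I : Finset ℤ}

theorem commute_of_mem_range {Λ₁ Λ₂ : Finset ℤ} (h₁ : Λ₁ ⊆ I) (h₂ : Λ₂ ⊆ I)
    (hd : Disjoint Λ₁ Λ₂) {P Q : Obs d I} (hP : P ∈ (embedHom (d := d) h₁).range)
    (hQ : Q ∈ (embedHom (d := d) h₂).range) : Commute P Q := by
  obtain ⟨P, rfl⟩ := hP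
  obtain ⟨Q, rfl⟩ := hQ
  exact commute_embed h₁ h₂ hd P Q

theorem exp_mem_range {Λ : Finset ℤ} (h : Λ ⊆ I) {Q : Obs d I}
    (hQ : Q ∈ (embedHom (d := d) h).range) :
    NormedSpace.exp Q ∈ (embedHom (d := d) h).range := by
  obtain ⟨Q, rfl⟩ := hQ
  exact ⟨NormedSpace.exp Q, embed_exp h Q⟩

theorem Interaction.localSum_mem_range (Φ : Interaction d) {Λ Λ' : Finset ℤ} (h : Λ ⊆ Λ')
    (h' : Λ' ⊆ I) : localSum (Φ.half I) Λ ∈ (embedHom (d := d) h').range := by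
  rw [Φ.localSum_half (h.trans h'), ← embed_embed h h']
  exact ⟨_, rfl⟩

theorem Interaction.expansional_mem_range (Φ : Interaction d) {a m b : ℤ} (ham : a ≤ m)
    (hmb : m ≤ b) (h : Finset.Ico a b ⊆ I) :
    expansional (Φ.half I) a m b ∈ (embedHom (d := d) h).range :=
  mul_mem (exp_mem_range h (neg_mem (Φ.localSum_mem_range (Finset.Subset.refl _) h)))
    (exp_mem_range h (add_mem
      (Φ.localSum_mem_range (Finset.Ico_subset_Ico_right hmb) h)
      (Φ.localSum_mem_range (Finset.Ico_subset_Ico_left ham) h)))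

theorem Interaction.gibbsKraus_mem_range (Φ : Interaction d) {C : Finset ℤ} (h : C ⊆ I) (z : ℝ)
    (p : Config d C × Config d C) :
    gibbsKraus (matUnit h) (localSum (Φ.half I) C) z p ∈ (embedHom (d := d) h).range := by
  rw [gibbsKraus, ← Complex.coe_smul]
  exact SMulMemClass.smul_mem _ (mul_mem ⟨_, rfl⟩
    (exp_mem_range h (neg_mem (Φ.localSum_mem_range (Finset.Subset.refl _) h))))

theorem kraus_smul {ι : Type*} [Fintype ι] (V : ι → Obs d I) (c : ℂ) (Q : Obs d I) :
    kraus V (c • Q) = c • kraus V Q := by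
  simp only [kraus, mul_smul_comm, smul_mul_assoc, ← Finset.smul_sum]

/-- The constant in the approximate Markov property. -/
def markovConst (r : ℕ) (J : ℝ) : ℝ := 1 + expTail (arakiRate r J) 0

/-- Cutting the chain changes the partition function by at most a constant factor, since the two
Boltzmann factors differ by an inverse expansional. -/
theorem hsSq_exp_le {a m b : ℤ} (φ : Finset ℤ → Obs d I) {K : ℝ}
    (hK : ‖expansionalInv φ a m b‖ ≤ K) :
    hsSq (NormedSpace.exp (-(localSum φ (Finset.Ico a m) + localSum φ (Finset.Ico m b))))
      ≤ K ^ 2 * hsSq (NormedSpace.exp (-localSum φ (Finset.Ico a b))) := by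
  have e : NormedSpace.exp (-(localSum φ (Finset.Ico a m) + localSum φ (Finset.Ico m b)))
      = expansionalInv φ a m b * NormedSpace.exp (-localSum φ (Finset.Ico a b)) := by
    rw [expansionalInv, mul_assoc, exp_mul_exp_neg, mul_one]
  rw [e]
  exact (hsSq_mul_le _ _).trans (mul_le_mul_of_nonneg_right
    (pow_le_pow_left₀ (norm_nonneg _) hK 2) (hsSq_nonneg _))

theorem expTail_pos {g : ℝ} (hg : 0 < g) (l : ℕ) : 0 < expTail g l := by
  rw [expTail_succ]
  have := expTail_nonneg hg.le (l + 1)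
  positivity

/-- The unnormalized approximate Markov property. -/
theorem Interaction.exists_markov_factorization [NeZero d] (Φ : Interaction d) {r : ℕ}
    (hr : 0 < r) {J : ℝ} {a m k n b : ℤ} (hloc : IsLocalFamily (Φ.half (Finset.Ico a b)) r J)
    (ham : a ≤ m) (hmk : m ≤ k) (hkn : k ≤ n) (hnb : n ≤ b) {l : ℕ}
    (hl : r * (l : ℤ) ≤ k - m) (hl' : r * (l : ℤ) ≤ n - k)
    (hA : Finset.Ico a m ⊆ Finset.Ico a b) (hC : Finset.Ico n b ⊆ Finset.Ico a b) :
    let G : Obs d (Finset.Ico a b) := NormedSpace.exp (-Φ.hamiltonian (Finset.Ico a b))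
    ∃ N D : Obs d (Finset.Ico a b),
      kraus (matUnit hA) (kraus (matUnit hC) G) * N = 1 ∧
      N * kraus (matUnit hA) (kraus (matUnit hC) G) = 1 ∧
      G - kraus (matUnit hC) G * N * kraus (matUnit hA) G =
        NormedSpace.exp (-(localSum (Φ.half (Finset.Ico a b)) (Finset.Ico a n) +
          localSum (Φ.half (Finset.Ico a b)) (Finset.Ico n b))) * D *
        NormedSpace.exp (-(localSum (Φ.half (Finset.Ico a b)) (Finset.Ico a m) +
          localSum (Φ.half (Finset.Ico a b)) (Finset.Ico m b))) ∧
      ‖D‖ ≤ 182 * markovConst r J ^ 27 * (2 * expTail (arakiRate r J) l) := by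
  intro G
  have sub : ∀ {x y : ℤ}, a ≤ x → y ≤ b → Finset.Ico x y ⊆ Finset.Ico a b :=
    fun h1 h2 => Finset.Ico_subset_Ico h1 h2
  have dis : ∀ {x y z w : ℤ}, y ≤ z → Disjoint (Finset.Ico x y) (Finset.Ico z w) := by
    intro x y z w hyz
    refine Finset.disjoint_left.2 fun t h1 h2 => ?_
    rw [Finset.mem_Ico] at h1 h2
    omega
  have hmn := hmk.trans hkn
  have han := ham.trans hmn
  have hmb := hmn.trans hnb
  have hak := ham.trans hmk
  have hkb := hkn.trans hnb
  have D := Φ.markovData hloc ham hmn hA hC (sub le_rfl hnb) (sub ham le_rfl)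
  set φ := Φ.half (Finset.Ico a b) with hφ
  have saI : IsSelfAdjoint (localSum φ (Finset.Ico a b)) :=
    Φ.isSelfAdjoint_localSum (Finset.Subset.refl _)
  have hG : G = NormedSpace.exp (-localSum φ (Finset.Ico a b)) *
      NormedSpace.exp (-localSum φ (Finset.Ico a b)) := Φ.exp_hamiltonian_eq _
  rw [hG]
  have bd : ∀ {x y z : ℤ}, x ≤ y → y ≤ z → ‖expansional φ x y z‖ ≤ markovConst r J ∧
      ‖expansionalInv φ x y z‖ ≤ markovConst r J := by
    intro x y z hxy hyz
    obtain ⟨h1, h2⟩ := hloc.norm_expansional_le hr hxy hyz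
    unfold markovConst
    exact ⟨by linarith, by linarith⟩
  have hl0 : (0 : ℤ) ≤ r * (l : ℤ) := by positivity
  have rX := Φ.expansional_mem_range ham hmk (sub le_rfl hkb)
  have rY := Φ.expansional_mem_range hkn hnb (sub hak le_rfl)
  have rV := Φ.gibbsKraus_mem_range hC
    (hsSq (NormedSpace.exp (-((2⁻¹ : ℝ) • Φ.hamiltonian (Finset.Ico n b)))))
  have rU := Φ.gibbsKraus_mem_range hA
    (hsSq (NormedSpace.exp (-((2⁻¹ : ℝ) • Φ.hamiltonian (Finset.Ico a m)))))
  rw [← hφ] at rX rY rV rU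
  obtain ⟨R, hR1, hR2, hR⟩ := norm_markov_defect_le
    (kraus_gibbsKraus_one D.saA D.zA_pos D.normA) (kraus_gibbsKraus_one D.saC D.zC_pos D.normC)
    -- X lives on [a, k) and Y on [k, b), hence they commute. The windows of size l at m and n stay
    -- on their own sides of k, so E and FA agree with X there, and E' and FC with Y.
    (X := expansional φ a m k) (Y := expansional φ k n b) (E := expansional φ a m n)
    (E' := expansional φ m n b) (FA := expansional φ a m b) (FC := expansional φ a n b)
    (K := markovConst r J) (η := 2 * expTail (arakiRate r J) l)
    (by have := expTail_nonneg (arakiRate_pos r J).le 0; unfold markovConst; linarith)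
    (bd ham hmk).1 (bd hkn hnb).1 (bd ham hmn).1 (bd hmn hnb).1 (bd ham hmb).1 (bd han hnb).1
    (bd ham hmk).2 (bd hkn hnb).2 (bd ham hmb).2 (bd hmn hnb).2
    (expansionalInv_mul φ a m k) (expansionalInv_mul φ k n b) (expansionalInv_mul φ a m b)
    (expansionalInv_mul φ m n b)
    (hloc.norm_expansional_sub_le hr ham hmn ham hmk l rfl (by unfold winHi; omega))
    (hloc.norm_expansional_sub_le hr hmn hnb hkn hnb l (by unfold winLo; omega) rfl)
    (hloc.norm_expansional_sub_le hr ham hmb ham hmk l rfl (by unfold winHi; omega))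
    (hloc.norm_expansional_sub_le hr han hnb hkn hnb l (by unfold winLo; omega) rfl)
    (commute_of_mem_range _ _ (dis le_rfl) rX rY)
    (commute_of_mem_range _ _ (dis le_rfl) rX (star_mem rY))
    (fun i => commute_of_mem_range _ _ (dis hkn) rX (rV i))
    (fun i => commute_of_mem_range _ _ (dis hkn) rX (star_mem (rV i)))
    (fun i => commute_of_mem_range _ _ (dis hmk).symm rY (rU i))
    (fun i => commute_of_mem_range _ _ (dis hmk).symm rY (star_mem (rU i)))
    (fun i j => commute_of_mem_range _ _ (dis hmn) (rU i) (rV j))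
    (fun i j => commute_of_mem_range _ _ (dis hmn) (rU i) (star_mem (rV j)))
  obtain ⟨N, hN1, hN2, hN⟩ := D.defect_eq saI (FA := expansional φ a m b)
    (FC := expansional φ a n b) (E := expansional φ a m n) (E' := expansional φ m n b)
    rfl rfl rfl rfl hR1 hR2
  exact ⟨N, _, hN1, hN2, hN, hR⟩

theorem Interaction.markov_estimate [NeZero d] (Φ : Interaction d) {r : ℕ}
    (hr : 0 < r) {J : ℝ} {a m k n b : ℤ} (hloc : IsLocalFamily (Φ.half (Finset.Ico a b)) r J)
    (ham : a ≤ m) (hmk : m ≤ k) (hkn : k ≤ n) (hnb : n ≤ b) {l : ℕ}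
    (hl : r * (l : ℤ) ≤ k - m) (hl' : r * (l : ℤ) ≤ n - k)
    (hAB : Finset.Ico a n ⊆ Finset.Ico a b) (hB : Finset.Ico m n ⊆ Finset.Ico a b)
    (hBC : Finset.Ico m b ⊆ Finset.Ico a b) :
    IsUnit (Φ.marginal hB) ∧
      traceNorm (Φ.gibbs (Finset.Ico a b) -
        Φ.marginal hAB * (Φ.marginal hB)⁻¹ * Φ.marginal hBC)
        ≤ 364 * markovConst r J ^ 29 * expTail (arakiRate r J) l := by
  have hmn := hmk.trans hkn
  have hA : Finset.Ico a m ⊆ Finset.Ico a b :=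
    Finset.Ico_subset_Ico_right (hmn.trans hnb)
  have hC : Finset.Ico n b ⊆ Finset.Ico a b :=
    Finset.Ico_subset_Ico_left (ham.trans hmn)
  obtain ⟨N, D, hN1, hN2, hN, hD⟩ :=
    Φ.exists_markov_factorization hr hloc ham hmk hkn hnb hl hl' hA hC
  have hGexp := Φ.exp_hamiltonian_eq (Finset.Ico a b)
  have hK : ∀ {x y z : ℤ}, x ≤ y → y ≤ z →
      ‖expansionalInv (Φ.half (Finset.Ico a b)) x y z‖ ≤ markovConst r J := by
    intro x y z hxy hyz
    have := (hloc.norm_expansional_le hr hxy hyz).2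
    unfold markovConst
    linarith
  have hX := hsSq_exp_le (Φ.half (Finset.Ico a b)) (hK (ham.trans hmn) hnb)
  have hY := hsSq_exp_le (Φ.half (Finset.Ico a b)) (hK ham (hmn.trans hnb))
  have hK1 : 1 ≤ markovConst r J := by
    have := expTail_nonneg (arakiRate_pos r J).le 0; unfold markovConst; linarith
  set z := hsSq (NormedSpace.exp (-localSum (Φ.half (Finset.Ico a b)) (Finset.Ico a b))) with hz
  have hz0 : 0 < z := hsSq_exp_pos _
  set G : Obs d (Finset.Ico a b) := NormedSpace.exp (-Φ.hamiltonian (Finset.Ico a b)) with hG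
  have htr : G.trace = (z : ℂ) := by
    rw [hGexp]
    exact trace_exp_eq (Φ.isSelfAdjoint_localSum (Finset.Subset.refl _))
  have hzC : (z : ℂ) ≠ 0 := by exact_mod_cast hz0.ne'
  have hgibbs : Φ.gibbs (Finset.Ico a b) = (z : ℂ)⁻¹ • G := by
    rw [Interaction.gibbs, ← hG, htr]
  have mem : ∀ {x y t : ℤ}, t ∈ Finset.Ico x y ↔ x ≤ t ∧ t < y := Finset.mem_Ico
  have eAB : Finset.Ico a b \ Finset.Ico a n = Finset.Ico n b := by
    ext t; rw [Finset.mem_sdiff, mem, mem, mem]; omega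
  have eBC : Finset.Ico a b \ Finset.Ico m b = Finset.Ico a m := by
    ext t; rw [Finset.mem_sdiff, mem, mem, mem]; omega
  have eB : Finset.Ico a b \ Finset.Ico m n = Finset.Ico a m ∪ Finset.Ico n b := by
    ext t; rw [Finset.mem_sdiff, Finset.mem_union, mem, mem, mem, mem]; omega
  have dAC : Disjoint (Finset.Ico a m) (Finset.Ico n b) :=
    Finset.disjoint_left.2 fun t h1 h2 => by rw [mem] at h1 h2; omega
  have mAB : Φ.marginal hAB = (z : ℂ)⁻¹ • kraus (matUnit hC) G := by
    rw [Interaction.marginal, hgibbs, reduced_eq_kraus hAB hC eAB, kraus_smul]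
  have mBC : Φ.marginal hBC = (z : ℂ)⁻¹ • kraus (matUnit hA) G := by
    rw [Interaction.marginal, hgibbs, reduced_eq_kraus hBC hA eBC, kraus_smul]
  have mB : Φ.marginal hB = (z : ℂ)⁻¹ • kraus (matUnit hA) (kraus (matUnit hC) G) := by
    rw [Interaction.marginal, hgibbs, reduced_eq_kraus hB (Finset.union_subset hA hC) eB,
      kraus_smul, kraus_matUnit_union hA hC dAC]
  have i1 : Φ.marginal hB * ((z : ℂ) • N) = 1 := by
    rw [mB, smul_mul_smul_comm, inv_mul_cancel₀ hzC, one_smul, hN1]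
  have i2 : ((z : ℂ) • N) * Φ.marginal hB = 1 := by
    rw [mB, smul_mul_smul_comm, mul_inv_cancel₀ hzC, one_smul, hN2]
  refine ⟨⟨⟨_, _, i1, i2⟩, rfl⟩, ?_⟩
  have hinv : (Φ.marginal hB)⁻¹ = (z : ℂ) • N := Matrix.inv_eq_right_inv i1
  have hfin : Φ.gibbs (Finset.Ico a b) - Φ.marginal hAB * (Φ.marginal hB)⁻¹ * Φ.marginal hBC
      = NormedSpace.exp (-(localSum (Φ.half (Finset.Ico a b)) (Finset.Ico a n) +
          localSum (Φ.half (Finset.Ico a b)) (Finset.Ico n b))) * ((z : ℂ)⁻¹ • D) *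
        NormedSpace.exp (-(localSum (Φ.half (Finset.Ico a b)) (Finset.Ico a m) +
          localSum (Φ.half (Finset.Ico a b)) (Finset.Ico m b))) := by
    rw [hinv, mAB, mBC, hgibbs, smul_mul_smul_comm, inv_mul_cancel₀ hzC, one_smul,
      mul_smul_comm, ← smul_sub, hN, mul_smul_comm, smul_mul_assoc]
  rw [hfin]
  have hE := expTail_pos (arakiRate_pos r J) l
  have hK0 : 0 < markovConst r J := by linarith
  have ht : 0 < z⁻¹ * (182 * markovConst r J ^ 27 * (2 * expTail (arakiRate r J) l)) := by
    positivity
  have hDz : ‖(z : ℂ)⁻¹ • D‖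
      ≤ z⁻¹ * (182 * markovConst r J ^ 27 * (2 * expTail (arakiRate r J) l)) := by
    rw [norm_smul, norm_inv, Complex.norm_real, Real.norm_of_nonneg hz0.le]
    exact mul_le_mul_of_nonneg_left hD (by positivity)
  refine (traceNorm_mul_mul_le _ _ _ ht hDz).trans ?_
  calc _ ≤ z⁻¹ * (182 * markovConst r J ^ 27 * (2 * expTail (arakiRate r J) l)) *
        (markovConst r J ^ 2 * z + markovConst r J ^ 2 * z) / 2 :=
      div_le_div_of_nonneg_right (mul_le_mul_of_nonneg_left (add_le_add hX hY) ht.le) zero_le_two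
    _ = _ := by
      field_simp
      ring

end Estimate

/-! ### The error function and its decay. -/

section Decay

/-- The error function in the approximate Markov property. -/
def markovError (r : ℕ) (J : ℝ) (ℓ : ℕ) : ℝ :=
  364 * markovConst r J ^ 29 * expTail (arakiRate r J) (ℓ / 2 / r) + ((ℓ + 1).factorial : ℝ)⁻¹

theorem markovConst_pos (r : ℕ) (J : ℝ) : 0 < markovConst r J := by
  have := expTail_nonneg (arakiRate_pos r J).le 0
  unfold markovConst
  linarith

theorem markovError_pos (r : ℕ) (J : ℝ) (ℓ : ℕ) : 0 < markovError r J ℓ := by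
  have h1 := expTail_pos (arakiRate_pos r J) (ℓ / 2 / r)
  have h2 := markovConst_pos r J
  unfold markovError
  positivity

theorem strictAnti_markovError (r : ℕ) (J : ℝ) : StrictAnti (markovError r J) := by
  intro i j hij
  refine add_lt_add_of_le_of_lt ?_ ?_
  · have h2 := markovConst_pos r J
    refine mul_le_mul_of_nonneg_left (expTail_antitone (arakiRate_pos r J).le ?_) (by positivity)
    exact Nat.div_le_div_right (Nat.div_le_div_right hij.le)
  -- The tail is constant on blocks of ℓ because of the integer divisions; the added 1/(ℓ + 1)!
  -- makes the decrease strict, and the shift by one avoids 0! = 1!.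
  · refine inv_strictAnti₀ (by positivity) ?_
    exact_mod_cast (Nat.factorial_lt (Nat.succ_pos i)).2 (Nat.succ_lt_succ hij)

theorem superexpDecay_markovError {r : ℕ} (hr : 0 < r) (J : ℝ) :
    SuperexpDecay (markovError r J) := by
  intro c
  have hg := (arakiRate_pos r J).le
  -- Since ℓ ≤ 2r(⌊ℓ/2r⌋ + 1), the weight e^{cℓ} is at most t to the power in `expTail_mul_pow_le`.
  set t := Real.exp (|c| * (2 * r)) with ht
  have ht1 : 1 ≤ t := Real.one_le_exp (by positivity)
  have h1 : Filter.Tendsto (fun ℓ : ℕ => expTail (arakiRate r J) (ℓ / 2 / r) * Real.exp (c * ℓ))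
      Filter.atTop (nhds 0) := by
    have hdiv : Filter.Tendsto (fun ℓ : ℕ => ℓ / 2 / r) Filter.atTop Filter.atTop :=
      (Nat.tendsto_div_const_atTop hr.ne').comp (Nat.tendsto_div_const_atTop two_ne_zero)
    refine squeeze_zero (fun ℓ => mul_nonneg (expTail_nonneg hg _) (Real.exp_pos _).le)
      (fun ℓ => ?_) ((tendsto_expTail (arakiRate r J * t)).comp hdiv)
    refine le_trans (mul_le_mul_of_nonneg_left ?_ (expTail_nonneg hg _))
      (expTail_mul_pow_le hg ht1 (ℓ / 2 / r))
    rw [ht, ← Real.exp_nat_mul, Real.exp_le_exp]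
    have hℓ : ℓ ≤ 2 * r * (ℓ / 2 / r + 1) := by
      rw [Nat.div_div_eq_div_mul]
      exact (Nat.lt_mul_div_succ ℓ (by positivity)).le
    have hℓ' : (ℓ : ℝ) ≤ 2 * r * ((ℓ / 2 / r : ℕ) + 1) := by exact_mod_cast hℓ
    calc c * ℓ ≤ |c| * ℓ := mul_le_mul_of_nonneg_right (le_abs_self c) (Nat.cast_nonneg ℓ)
      _ ≤ |c| * (2 * r * ((ℓ / 2 / r : ℕ) + 1)) :=
        mul_le_mul_of_nonneg_left hℓ' (abs_nonneg c)
      _ = _ := by push_cast; ring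
  have h2 : Filter.Tendsto (fun ℓ : ℕ => ((ℓ + 1).factorial : ℝ)⁻¹ * Real.exp (c * ℓ))
      Filter.atTop (nhds 0) := by
    refine squeeze_zero (fun ℓ => by positivity) (fun ℓ => ?_)
      (FloorSemiring.tendsto_pow_div_factorial_atTop (Real.exp c))
    rw [← Real.exp_nat_mul, div_eq_inv_mul, mul_comm (ℓ : ℝ) c]
    gcongr
    exact Nat.le_succ ℓ
  have h3 := (h1.const_mul (364 * markovConst r J ^ 29)).add h2
  rw [mul_zero, add_zero] at h3
  refine h3.congr fun ℓ => ?_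
  rw [markovError]
  ring

end Decay

end SpinChain

end

/-- The interval is `I = ABC` with `A = [a, m)`, `B = [m, n)`, `C = [n, b)` in `ℤ`, so that
`AB = [a, n)` and `BC = [m, b)`. -/
theorem theorem5p2 (r : ℕ) (hr : 0 < r) (J : ℝ) (hJ : 0 < J) :
    ∃ ε : ℕ → ℝ, (∀ ℓ, 0 < ε ℓ) ∧ StrictAnti ε ∧ SpinChain.SuperexpDecay ε ∧
      ∀ (d : ℕ) (_ : 0 < d) (Φ : SpinChain.Interaction d), Φ.HasRange r → Φ.HasStrength J →
      ∀ (a m n b : ℤ) (ham : a ≤ m) (_ : m ≤ n) (hnb : n ≤ b)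
        (ℓ : ℕ), ℓ ≤ (Finset.Ico m n).card →
        IsUnit (Φ.marginal (Finset.Ico_subset_Ico ham hnb : Finset.Ico m n ⊆ Finset.Ico a b)) ∧
        SpinChain.traceNorm
          (Φ.gibbs (Finset.Ico a b) -
            Φ.marginal (Finset.Ico_subset_Ico le_rfl hnb : Finset.Ico a n ⊆ Finset.Ico a b) *
              (Φ.marginal (Finset.Ico_subset_Ico ham hnb : Finset.Ico m n ⊆ Finset.Ico a b))⁻¹ *
              Φ.marginal (Finset.Ico_subset_Ico ham le_rfl : Finset.Ico m b ⊆ Finset.Ico a b))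
          ≤ ε ℓ := by
  refine ⟨SpinChain.markovError r J, SpinChain.markovError_pos r J,
    SpinChain.strictAnti_markovError r J, SpinChain.superexpDecay_markovError hr J, ?_⟩
  intro d hd Φ hrange hstrength a m n b ham hmn hnb ℓ hℓ
  have : NeZero d := ⟨hd.ne'⟩
  rw [Int.card_Ico] at hℓ
  have hmul : (r : ℤ) * ((ℓ / 2 / r : ℕ) : ℤ) ≤ ((ℓ / 2 : ℕ) : ℤ) := by
    exact_mod_cast Nat.mul_div_le (ℓ / 2) r
  -- The splitting point k leaves at least ⌊ℓ/2⌋ sites of B on either side, room for a window of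
  -- ⌊ℓ/2⌋/r steps of length r at each cut.
  obtain ⟨h1, h2⟩ := Φ.markov_estimate hr (k := m + ((ℓ / 2 : ℕ) : ℤ)) (l := ℓ / 2 / r)
    (Φ.isLocalFamily_half hJ hrange hstrength (Finset.Ico a b)) ham (by omega) (by omega) hnb
    (by omega) (by omega) (Finset.Ico_subset_Ico le_rfl hnb) (Finset.Ico_subset_Ico ham hnb)
    (Finset.Ico_subset_Ico ham le_rfl)
  refine ⟨h1, h2.trans ?_⟩
  rw [SpinChain.markovError]
  exact le_add_of_nonneg_right (by positivity)
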